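/- **Setting.** Let $\mu$ be a regular cardinal and let $\mathbf K=(K,\le_{\mathbf K})$ be a $\mu$-AEC: $K$ is a class of structures in a fixed vocabulary $\tau$ whose symbols have arity $<\mu$; $\le_{\mathbf K}$ is a partial order on $K$ refining the substructure relation; both are closed under isomorphism; and * (coherence) $M_0\subseteq M_1\le_{\mathbf K}M_2$ and $M_0\le_{\mathbf K}M_2$ imply $M_0\le_{\mathbf K}M_1$; * (chain axioms) for every $\mu$-directed system $\langle M_i\rangle_{i\in I}$ in $\mathbf K$, the union $M=\bigcup_i M_i$ is in $K$, $M_i\le_{\mathbf K}M$ for all $i$, and $M\le_{\mathbf K}N$ whenever $M_i\le_{\mathbf K}N$ for all $i$; * (Löwenheim–Skolem–Tarski) there is a cardinal $\lambda=\lambda^{<\mu}\ge|\tau|+\mu$ such that for all $M\in K$ and all subsets $A$ of the universe $UM$ there is $M_0\le_{\mathbf K}M$ with $A\subseteq UM_0$ and $|UM_0|\le|A|^{<\mu}+\lambda$. A $\mathbf K$-embedding $f:M\to N$ is an isomorphism of $M$ onto some $f[M]\le_{\mathbf K}N$; with these morphisms $\mathbf K$ is a category. $\mathbf K$ *has chain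 bounds* if every increasing chain $\langle M_i\rangle_{i<\delta}$ in $\mathbf K$, indexed by a nonzero ordinal, has an upper bound in $\mathbf K$. **Independence relations.** An amalgam of a span $(f_1:M_0\to M_1,\ f_2:M_0\to M_2)$ is a cospan $(g_1:M_1\to M_3,\ g_2:M_2\to M_3)$ with $g_1f_1=g_2f_2$. Let $\sim$ be the transitive closure of the relation between amalgams $(g_1,g_2)$, $(g_1',g_2')$ of the same span "there are $h,h'$ with a common codomain such that $hg_1=h'g_1'$ and $hg_2=h'g_2'$". An *independence relation* $\perp$ on a category is a class of amalgamation diagrams $(f_1,f_2,g_1,g_2)$ closed under $\sim$; its *dual* is $\perp^d(f_1,f_2,g_1,g_2)\Leftrightarrow\ \perp(f_2,f_1,g_2,g_1)$. The relation $\perp$ * is *symmetric* if $\perp=\perp^d$, and *invariant* if it is invariant under isomorphism of amalgamation diagrams; * has *existence* if every span has an independent amalgam, and *uniqueness* if any two independent amalgams of the same span are $\sim$-equivalent; * is *right transitive* if $\perp(f_{01},f_{02},f_{13},f_{23})$ and $\perp(f_{23},f_{24},f_{35},f_{45})$ imply $\perp(f_{01},f_{24}f_{02},f_{35}f_{13},f_{45})$;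 *left transitive* if $\perp^d$ is right transitive; and *transitive* if both; * (having existence) is *right accessible* if it is right transitive and the following category is accessible: its objects are the morphisms of the given category, and a morphism from $f:M_1\to M_2$ to $g:N_1\to N_2$ is a pair $(h_1:M_1\to N_1,\ h_2:M_2\to N_2)$ with $\perp(f,h_1,h_2,g)$. It is *left accessible* if $\perp^d$ is right accessible, and *accessible* if both; * is *stable* if it is symmetric, transitive, accessible, and has existence and uniqueness. For $\perp$ on $\mathbf K$, write $\perp(M_0,M_1,M_2,M_3)$ if $M_0\le_{\mathbf K}M_\ell\le_{\mathbf K}M_3$ for $\ell=1,2$ and the diagram of inclusions is independent. For $N_0\le_{\mathbf K}N_3$ and $A,B\subseteq UN_3$, write $\overline{\perp}(N_0,A,B,N_3)$ if there are $M_1,M_2,M_3$ with $N_3\le_{\mathbf K}M_3$, $A\subseteq UM_1$, $B\subseteq UM_2$ and $\perp(N_0,M_1,M_2,M_3)$. * $\perp$ has *right local character* if for every cardinal $\alpha$ there is a cardinal $\lambda$ such that for all $M\le_{\mathbf K}N$ and every sequence $\bar a$ of length $\alpha$ from $N$ there is $M_0\le_{\mathbf K}M$ with $|UM_0|\le\lambda$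 and $\overline{\perp}(M_0,\operatorname{ran}\bar a,UM,N)$ (that is, the Galois type of $\bar a$ over $M$ does not fork over $M_0$). * $\perp$ has the *right witness property* if for some infinite cardinal $\theta$: whenever $M_0\le_{\mathbf K}M_\ell\le_{\mathbf K}M_3$ ($\ell=1,2$) and $\overline{\perp}(M_0,UM_1,A,M_3)$ for all $A\subseteq UM_2$ with $|A|<\theta$, then $\perp(M_0,M_1,M_2,M_3)$. It has the *left witness property* if $\perp^d$ has the right witness property. **Statement.** Let $\mathbf K$ be a $\mu$-AEC which has chain bounds, and let $\perp$ be an invariant, transitive independence relation on $\mathbf K$ with existence, uniqueness and right local character. Then $\perp$ is symmetric. Moreover, if $\perp$ has the right witness property or the left witness property, then $\perp$ is a stable independence relation. -/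

import Mathlib

open CategoryTheory Limits Cardinal

universe u v w

/-! ## Independence relations on an arbitrary category -/

section Category

variable {C : Type w} [Category.{v} C]

/-- An amalgam of the span `(f₁, f₂)`. -/
structure Amalgam {M₀ M₁ M₂ : C} (f₁ : M₀ ⟶ M₁) (f₂ : M₀ ⟶ M₂) where
  pt : C
  inl : M₁ ⟶ pt
  inr : M₂ ⟶ pt
  comm : f₁ ≫ inl = f₂ ≫ inr

namespace Amalgam

variable {M₀ M₁ M₂ : C} {f₁ : M₀ ⟶ M₁} {f₂ : M₀ ⟶ M₂}

/-- The relation `∼*`: the two amalgams embed compatibly into a common object. -/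
def EquivStar (a b : Amalgam f₁ f₂) : Prop :=
  ∃ (N : C) (ga : a.pt ⟶ N) (gb : b.pt ⟶ N),
    a.inl ≫ ga = b.inl ≫ gb ∧ a.inr ≫ ga = b.inr ≫ gb

/-- The relation `∼`, the transitive closure of `∼*`. -/
def Equivalent (a b : Amalgam f₁ f₂) : Prop :=
  Relation.TransGen EquivStar a b

/-- The amalgam of `(f₂, f₁)` obtained by exchanging the two sides. -/
def swap (a : Amalgam f₁ f₂) : Amalgam f₂ f₁ :=
  ⟨a.pt, a.inr, a.inl, a.comm.symm⟩

theorem Equivalent.swap {a b : Amalgam f₁ f₂} (h : a.Equivalent b) :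
    a.swap.Equivalent b.swap :=
  Relation.TransGen.lift Amalgam.swap
    (fun _ _ ⟨N, ga, gb, h₁, h₂⟩ => ⟨N, ga, gb, h₂, h₁⟩) _ _ h

end Amalgam

variable (C) in
/-- An independence relation on `C`: a class of amalgamation diagrams closed under `∼`.
`Indep f₁ f₂ g₁ g₂` concerns the square with sides `f₁ : M₀ ⟶ M₁`, `f₂ : M₀ ⟶ M₂`,
`g₁ : M₁ ⟶ M₃`, `g₂ : M₂ ⟶ M₃`. -/
@[ext]
structure IndepRel where
  Indep : ∀ {M₀ M₁ M₂ M₃ : C}, (M₀ ⟶ M₁) → (M₀ ⟶ M₂) → (M₁ ⟶ M₃) → (M₂ ⟶ M₃) → Prop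
  comm : ∀ {M₀ M₁ M₂ M₃ : C} {f₁ : M₀ ⟶ M₁} {f₂ : M₀ ⟶ M₂} {g₁ : M₁ ⟶ M₃} {g₂ : M₂ ⟶ M₃},
    Indep f₁ f₂ g₁ g₂ → f₁ ≫ g₁ = f₂ ≫ g₂
  closed : ∀ {M₀ M₁ M₂ : C} {f₁ : M₀ ⟶ M₁} {f₂ : M₀ ⟶ M₂} {a b : Amalgam f₁ f₂},
    a.Equivalent b → Indep f₁ f₂ a.inl a.inr → Indep f₁ f₂ b.inl b.inr

namespace IndepRel

/-- The dual relation: exchange left and right. -/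
def dual (nf : IndepRel C) : IndepRel C where
  Indep f₁ f₂ g₁ g₂ := nf.Indep f₂ f₁ g₂ g₁
  comm h := (nf.comm h).symm
  closed hab h := nf.closed hab.swap h

variable (nf : IndepRel C)

def Symmetric : Prop := nf = nf.dual

/-- Invariance under isomorphisms of amalgamation diagrams. -/
def Invariant : Prop :=
  ∀ {M₀ M₁ M₂ M₃ N₀ N₁ N₂ N₃ : C}
    (f₁ : M₀ ⟶ M₁) (f₂ : M₀ ⟶ M₂) (g₁ : M₁ ⟶ M₃) (g₂ : M₂ ⟶ M₃)
    (f₁' : N₀ ⟶ N₁) (f₂' : N₀ ⟶ N₂) (g₁' : N₁ ⟶ N₃) (g₂' : N₂ ⟶ N₃)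
    (e₀ : M₀ ≅ N₀) (e₁ : M₁ ≅ N₁) (e₂ : M₂ ≅ N₂) (e₃ : M₃ ≅ N₃),
    f₁ ≫ e₁.hom = e₀.hom ≫ f₁' → f₂ ≫ e₂.hom = e₀.hom ≫ f₂' →
    g₁ ≫ e₃.hom = e₁.hom ≫ g₁' → g₂ ≫ e₃.hom = e₂.hom ≫ g₂' →
    nf.Indep f₁ f₂ g₁ g₂ → nf.Indep f₁' f₂' g₁' g₂'

/-- Every span has an independent amalgam. -/
def Existence : Prop :=
  ∀ {M₀ M₁ M₂ : C} (f₁ : M₀ ⟶ M₁) (f₂ : M₀ ⟶ M₂),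
    ∃ (M₃ : C) (g₁ : M₁ ⟶ M₃) (g₂ : M₂ ⟶ M₃), nf.Indep f₁ f₂ g₁ g₂

/-- Any two independent amalgams of the same span are equivalent. -/
def Uniqueness : Prop :=
  ∀ {M₀ M₁ M₂ : C} {f₁ : M₀ ⟶ M₁} {f₂ : M₀ ⟶ M₂} (a b : Amalgam f₁ f₂),
    nf.Indep f₁ f₂ a.inl a.inr → nf.Indep f₁ f₂ b.inl b.inr → a.Equivalent b

/-- Independent squares compose horizontally. -/
def RightTransitive : Prop :=
  ∀ {M₀ M₁ M₂ M₃ M₄ M₅ : C} (f₀₁ : M₀ ⟶ M₁) (f₀₂ : M₀ ⟶ M₂) (f₁₃ : M₁ ⟶ M₃)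
    (f₂₃ : M₂ ⟶ M₃) (f₂₄ : M₂ ⟶ M₄) (f₃₅ : M₃ ⟶ M₅) (f₄₅ : M₄ ⟶ M₅),
    nf.Indep f₀₁ f₀₂ f₁₃ f₂₃ → nf.Indep f₂₃ f₂₄ f₃₅ f₄₅ →
    nf.Indep f₀₁ (f₀₂ ≫ f₂₄) (f₁₃ ≫ f₃₅) f₄₅

def LeftTransitive : Prop := nf.dual.RightTransitive

def Transitive : Prop := nf.LeftTransitive ∧ nf.RightTransitive

variable {nf}

/-- With existence, a commutative square whose bottom side is an identity and whose
vertical sides agree is independent; this provides the identities of the category below. -/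
theorem Existence.indep_id (hE : nf.Existence) {M N : C} (f : M ⟶ N) :
    nf.Indep f (𝟙 M) (𝟙 N) f := by
  obtain ⟨P, h₁, h₂, h⟩ := hE f (𝟙 M)
  have hc := nf.comm h
  simp only [Category.id_comp] at hc
  refine nf.closed (a := ⟨P, h₁, h₂, nf.comm h⟩) (b := ⟨N, 𝟙 N, f, by simp⟩)
    (Relation.TransGen.single ⟨P, 𝟙 P, h₁, ?_, ?_⟩) h
  · simp
  · simp [hc]

variable (nf)

/-- The objects of the category `C_NF` of a right transitive independence relation with
existence: the morphisms of `C`. -/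
structure NF (hT : nf.RightTransitive) (hE : nf.Existence) where
  {source : C}
  {target : C}
  map : source ⟶ target

/-- A morphism of `C_NF` from `f` to `g` is an independent square with vertical
sides `f` and `g`. -/
@[ext]
structure NF.Hom {nf : IndepRel C} {hT : nf.RightTransitive} {hE : nf.Existence}
    (f g : nf.NF hT hE) where
  bot : f.source ⟶ g.source
  top : f.target ⟶ g.target
  indep : nf.Indep f.map bot top g.map

instance (hT : nf.RightTransitive) (hE : nf.Existence) : Category (nf.NF hT hE) where
  Hom f g := NF.Hom f g
  id f := ⟨𝟙 _, 𝟙 _, hE.indep_id f.map⟩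
  comp a b := ⟨a.bot ≫ b.bot, a.top ≫ b.top, hT _ _ _ _ _ _ _ a.indep b.indep⟩
  id_comp _ := NF.Hom.ext (Category.id_comp _) (Category.id_comp _)
  comp_id _ := NF.Hom.ext (Category.comp_id _) (Category.comp_id _)
  assoc _ _ _ := NF.Hom.ext (Category.assoc _ _ _) (Category.assoc _ _ _)

/-- Right accessibility: the category `C_NF` is defined and is an accessible category. -/
def RightAccessible : Prop :=
  ∃ (hT : nf.RightTransitive) (hE : nf.Existence), IsAccessibleCategory.{v} (nf.NF hT hE)

def LeftAccessible : Prop := nf.dual.RightAccessible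

def Accessible : Prop := nf.LeftAccessible ∧ nf.RightAccessible

/-- Stable independence relations. -/
structure Stable : Prop where
  symmetric : nf.Symmetric
  transitive : nf.Transitive
  accessible : nf.Accessible
  existence : nf.Existence
  uniqueness : nf.Uniqueness

end IndepRel

end Category

/-! ## Structures in an infinitary vocabulary, abstract classes and `μ`-AECs -/

/-- A `μ`-ary vocabulary: sets of function and relation symbols, each with an arity of
cardinality less than `μ`. -/
structure Vocabulary (μ : Cardinal.{u}) where
  Fn : Type u
  Rel : Type u
  fnArity : Fn → Type u
  relArity : Rel → Type u
  fnArity_lt : ∀ s, #(fnArity s) < μ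
  relArity_lt : ∀ r, #(relArity r) < μ

/-- The number of symbols of a vocabulary. -/
def Vocabulary.card {μ : Cardinal.{u}} (τ : Vocabulary μ) : Cardinal.{u} := #(τ.Fn ⊕ τ.Rel)

/-- `τ`-structures. -/
structure Str {μ : Cardinal.{u}} (τ : Vocabulary μ) where
  carrier : Type u
  fn : ∀ s : τ.Fn, (τ.fnArity s → carrier) → carrier
  rel : ∀ r : τ.Rel, (τ.relArity r → carrier) → Prop

/-- Embeddings of `τ`-structures: injective, and relations are preserved and reflected. -/
@[ext]
structure Str.Emb {μ : Cardinal.{u}} {τ : Vocabulary μ} (M N : Str τ) where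
  toFun : M.carrier → N.carrier
  injective : Function.Injective toFun
  map_fn : ∀ s x, toFun (M.fn s x) = N.fn s (toFun ∘ x)
  map_rel : ∀ r x, N.rel r (toFun ∘ x) ↔ M.rel r x

/-- `τ`-structures with embeddings. -/
instance {μ : Cardinal.{u}} {τ : Vocabulary μ} : Category.{u} (Str τ) where
  Hom M N := Str.Emb M N
  id M := ⟨id, fun _ _ h => h, fun _ _ => rfl, fun _ _ => Iff.rfl⟩
  comp f g := ⟨g.toFun ∘ f.toFun, g.injective.comp f.injective,
    fun s x => by simp only [Function.comp_apply, f.map_fn, g.map_fn, Function.comp_assoc],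
    fun r x => by rw [← f.map_rel, ← g.map_rel, Function.comp_assoc]⟩

/-- A (`μ`-ary) abstract class in the vocabulary `τ`, presented by its `K`-embeddings:
`mem M` says that `M` belongs to the class, and `strong f`, for an embedding `f : M ⟶ N`,
says that `f` is an isomorphism from `M` onto some `M' ≤_K N`. In particular, for a
substructure `M` of `N`, `M ≤_K N` means that the inclusion is strong. A surjective embedding
is an isomorphism of structures, so `of_iso` expresses closure under isomorphism. -/
structure AbstractClass {μ : Cardinal.{u}} (τ : Vocabulary μ) where
  mem : Str τ → Prop
  strong : ∀ {M N : Str τ}, (M ⟶ N) → Prop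
  mem_of_strong : ∀ {M N : Str τ} {f : M ⟶ N}, strong f → mem M ∧ mem N
  of_iso : ∀ {M N : Str τ} (f : M ⟶ N), Function.Surjective f.toFun →
    (mem M ∨ mem N) → strong f
  comp : ∀ {M N P : Str τ} {f : M ⟶ N} {g : N ⟶ P}, strong f → strong g → strong (f ≫ g)

namespace AbstractClass

variable {μ : Cardinal.{u}} {τ : Vocabulary μ}

/-- The members of an abstract class. -/
structure Obj (K : AbstractClass τ) where
  str : Str τ
  mem : K.mem str

/-- The `K`-embeddings between members of an abstract class. -/
@[ext]
structure Hom (K : AbstractClass τ) (M N : K.Obj) where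
  emb : M.str ⟶ N.str
  strong : K.strong emb

instance (K : AbstractClass τ) : Category.{u} K.Obj where
  Hom M N := Hom K M N
  id M := ⟨𝟙 M.str, K.of_iso _ Function.surjective_id (Or.inl M.mem)⟩
  comp f g := ⟨f.emb ≫ g.emb, K.comp f.strong g.strong⟩

/-- The function underlying a `K`-embedding. -/
def fn {K : AbstractClass τ} {M N : K.Obj} (f : M ⟶ N) : M.str.carrier → N.str.carrier :=
  (Hom.emb f).toFun

/-- The functor to `τ`-structures. -/
def toStr (K : AbstractClass τ) : K.Obj ⥤ Str τ where
  obj M := M.str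
  map f := Hom.emb f

/-- `K` is a `μ`-AEC (for `μ` regular). In the chain axioms, the union of a `μ`-directed system
is described, up to isomorphism, as a structure `c.pt` with a compatible, jointly surjective
family of embeddings of the members of the system. -/
structure IsMuAEC (K : AbstractClass τ) : Prop where
  coherence : ∀ {M₀ M₁ M₂ : Str τ} (f : M₀ ⟶ M₁) (g : M₁ ⟶ M₂),
    K.strong g → K.strong (f ≫ g) → K.strong f
  chain : ∀ (I : Type u) [PartialOrder I], (∀ S : Set I, #S < μ → BddAbove S) →
    ∀ (D : I ⥤ K.Obj) (c : Cocone (D ⋙ K.toStr)),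
      (∀ x : c.pt.carrier, ∃ i, x ∈ Set.range (c.ι.app i).toFun) →
      K.mem c.pt ∧ (∀ i, K.strong (c.ι.app i)) ∧
        ∀ (N : Str τ) (h : c.pt ⟶ N), (∀ i, K.strong (c.ι.app i ≫ h)) → K.strong h
  lst : ∃ lam : Cardinal.{u}, lam ^< μ = lam ∧ τ.card + μ ≤ lam ∧
    ∀ (M : K.Obj) (A : Set M.str.carrier), ∃ (M₀ : K.Obj) (f : M₀ ⟶ M),
      A ⊆ Set.range (fn f) ∧ #M₀.str.carrier ≤ #A ^< μ + lam

/-- Every nonempty well-ordered system in `K` has an upper bound. -/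
def HasChainBounds (K : AbstractClass τ) : Prop :=
  ∀ (I : Type u) [LinearOrder I] [WellFoundedLT I] [Nonempty I] (D : I ⥤ K.Obj),
    Nonempty (Cocone D)

end AbstractClass

/-! ## Local character and the witness property -/

namespace IndepRel

open AbstractClass

variable {μ : Cardinal.{u}} {τ : Vocabulary μ} {K : AbstractClass τ} (nf : IndepRel K.Obj)

/-- The closure of `nf` to subsets `A`, `B` of `N₃`, over the base `i : N₀ ⟶ N₃`: after
extending `N₃` to some `M₃`, there are `M₁ ⊇ A` and `M₂ ⊇ B` independent over `N₀`
inside `M₃`. -/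
def Closure {N₀ N₃ : K.Obj} (i : N₀ ⟶ N₃) (A B : Set N₃.str.carrier) : Prop :=
  ∃ (M₁ M₂ M₃ : K.Obj) (j : N₃ ⟶ M₃) (f₁ : N₀ ⟶ M₁) (f₂ : N₀ ⟶ M₂) (g₁ : M₁ ⟶ M₃)
    (g₂ : M₂ ⟶ M₃), nf.Indep f₁ f₂ g₁ g₂ ∧ f₁ ≫ g₁ = i ≫ j ∧
      fn j '' A ⊆ Set.range (fn g₁) ∧ fn j '' B ⊆ Set.range (fn g₂)

/-- For each `α` there is `lam` such that the Galois type over `M` of any sequence `a` of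
length `α` in any `N ≥ M` does not fork over some `M₀ ≤ M` of size at most `lam`. -/
def RightLocalCharacter : Prop :=
  ∀ α : Cardinal.{u}, ∃ lam : Cardinal.{u}, ∀ (M N : K.Obj) (i : M ⟶ N)
    (ι : Type u) (a : ι → N.str.carrier), #ι = α →
    ∃ (M₀ : K.Obj) (k : M₀ ⟶ M), #M₀.str.carrier ≤ lam ∧
      nf.Closure (k ≫ i) (Set.range a) (Set.range (fn i))

/-- The right `(< θ)`-witness property. -/
def RightWitnessPropertyAt (θ : Cardinal.{u}) : Prop :=
  ∀ {M₀ M₁ M₂ M₃ : K.Obj} (f₁ : M₀ ⟶ M₁) (f₂ : M₀ ⟶ M₂) (g₁ : M₁ ⟶ M₃) (g₂ : M₂ ⟶ M₃),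
    f₁ ≫ g₁ = f₂ ≫ g₂ →
    (∀ A : Set M₂.str.carrier, #A < θ →
      nf.Closure (f₁ ≫ g₁) (Set.range (fn g₁)) (fn g₂ '' A)) →
    nf.Indep f₁ f₂ g₁ g₂

/-- The right witness property: it holds at some infinite cardinal. -/
def RightWitnessProperty : Prop := ∃ θ : Cardinal.{u}, ℵ₀ ≤ θ ∧ nf.RightWitnessPropertyAt θ

def LeftWitnessProperty : Prop := nf.dual.RightWitnessProperty

end IndepRel

/-! Symmetry. Suppose `M₁` is independent from `M₂` over `M₀`, with `M₁` on the left. Build a chain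
of regular length `δ`, with `δ` above the local character bound for tuples of length `|M₂|`, in
which every stage `g i` extends a bound `r i` of the earlier stages by a copy of `M₁` that is
independent (on the right) from `r i` over `M₀`. Amalgamate the union of the chain, on the left,
with `M₂` on the right, independently over `M₀`. By local character the type of `M₂` over the union
does not fork over a set of size less than `δ`, hence not over some `r i`. So `M₂`, now on the left,
is independent from `g i` over `r i`, and left transitivity makes it independent over `M₀` from the
copy of `M₁` in `g i`. That copy and `M₂` are thus independent in both orders; by uniqueness the
original amalgam is equivalent to theirs, so it is independent in both orders too
(`symmetric_of_rightLocalCharacter`).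

Accessibility. By symmetry one side suffices. The witness property, applied on both sides through
symmetry, shows that sufficiently directed colimits of independent squares are computed as unions of
sources and of targets (`NF.nonempty_isColimit`). Morphisms between small objects are then
presentable, and there is only a set of them up to isomorphism. They generate: a closing-off
argument that adds the bases supplied by local character covers every small part of a morphism by a
small morphism with an independent square into it (`exists_indep_small`). -/

/-! ### Monotonicity from existence, uniqueness and transitivity -/

section IndepRelBasics

variable {C : Type w} [Category.{v} C]

namespace Amalgam

variable {M₀ M₁ M₂ M₂' : C} {f₁ : M₀ ⟶ M₁}

/-- Restriction of the right side of an amalgam. -/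
def restrict {f₂ : M₀ ⟶ M₂} {f : M₂ ⟶ M₂'} (a : Amalgam f₁ (f₂ ≫ f)) : Amalgam f₁ f₂ :=
  ⟨a.pt, a.inl, f ≫ a.inr, by rw [a.comm, Category.assoc]⟩

theorem Equivalent.restrict {f₂ : M₀ ⟶ M₂} {f : M₂ ⟶ M₂'} {a b : Amalgam f₁ (f₂ ≫ f)}
    (h : a.Equivalent b) : a.restrict.Equivalent b.restrict :=
  Relation.TransGen.lift Amalgam.restrict
    (fun a b ⟨N, ga, gb, h₁, h₂⟩ => ⟨N, ga, gb, h₁, by simp [Amalgam.restrict, h₂]⟩) _ _ h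

/-- Existence includes the amalgamation property, so two successive common extensions can be merged
over the middle amalgam, and no transitive closure is needed. -/
theorem Equivalent.equivStar {nf : IndepRel C} (hE : nf.Existence) {f₂ : M₀ ⟶ M₂}
    {a b : Amalgam f₁ f₂} (h : a.Equivalent b) : a.EquivStar b := by
  induction h with
  | single h => exact h
  | tail _ h ih =>
    obtain ⟨N, x, y, h₁, h₂⟩ := ih
    obtain ⟨N', x', y', h₁', h₂'⟩ := h
    obtain ⟨P, p, q, hpq⟩ := hE y x'
    have hc := nf.comm hpq
    refine ⟨P, x ≫ p, y' ≫ q, ?_, ?_⟩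
    · rw [← Category.assoc, h₁, Category.assoc, hc, ← Category.assoc, h₁', Category.assoc]
    · rw [← Category.assoc, h₂, Category.assoc, hc, ← Category.assoc, h₂', Category.assoc]

end Amalgam

namespace IndepRel

variable {nf : IndepRel C}

theorem indep_postcomp {M₀ M₁ M₂ M₃ N : C} {f₁ : M₀ ⟶ M₁} {f₂ : M₀ ⟶ M₂} {g₁ : M₁ ⟶ M₃}
    {g₂ : M₂ ⟶ M₃} (h : nf.Indep f₁ f₂ g₁ g₂) (k : M₃ ⟶ N) :
    nf.Indep f₁ f₂ (g₁ ≫ k) (g₂ ≫ k) :=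
  nf.closed (a := ⟨M₃, g₁, g₂, nf.comm h⟩)
    (b := ⟨N, g₁ ≫ k, g₂ ≫ k, by simp only [← Category.assoc, nf.comm h]⟩)
    (.single ⟨N, k, 𝟙 N, by simp, by simp⟩) h

theorem indep_of_postcomp {M₀ M₁ M₂ M₃ N : C} {f₁ : M₀ ⟶ M₁} {f₂ : M₀ ⟶ M₂} {g₁ : M₁ ⟶ M₃}
    {g₂ : M₂ ⟶ M₃} (hc : f₁ ≫ g₁ = f₂ ≫ g₂) (k : M₃ ⟶ N)
    (h : nf.Indep f₁ f₂ (g₁ ≫ k) (g₂ ≫ k)) : nf.Indep f₁ f₂ g₁ g₂ :=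
  nf.closed (b := ⟨M₃, g₁, g₂, hc⟩) (a := ⟨N, g₁ ≫ k, g₂ ≫ k, nf.comm h⟩)
    (.single ⟨N, 𝟙 N, k, by simp, by simp⟩) h

theorem Existence.dual (hE : nf.Existence) : nf.dual.Existence := fun f₁ f₂ =>
  let ⟨M₃, g₁, g₂, h⟩ := hE f₂ f₁
  ⟨M₃, g₂, g₁, h⟩

theorem Uniqueness.dual (hU : nf.Uniqueness) : nf.dual.Uniqueness := fun a b ha hb =>
  (hU a.swap b.swap ha hb).swap

/-- Amalgamate `M₁` independently first with `M₂` and then with `M₂'` over `M₂`. Right transitivity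
and uniqueness identify the result with the given amalgam, and its restriction to `M₂` is
independent by construction. -/
theorem RightTransitive.indep_mono_right (hT : nf.RightTransitive) (hE : nf.Existence)
    (hU : nf.Uniqueness) {M₀ M₁ M₂ M₂' M₃ : C} {f₁ : M₀ ⟶ M₁} {f₂ : M₀ ⟶ M₂} {f : M₂ ⟶ M₂'}
    {g₁ : M₁ ⟶ M₃} {g₂ : M₂' ⟶ M₃} (h : nf.Indep f₁ (f₂ ≫ f) g₁ g₂) :
    nf.Indep f₁ f₂ g₁ (f ≫ g₂) := by
  obtain ⟨P, u, v, huv⟩ := hE f₁ f₂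
  obtain ⟨Q, p, q, hpq⟩ := hE v f
  have e := hU ⟨Q, u ≫ p, q, nf.comm (hT _ _ _ _ _ _ _ huv hpq)⟩ ⟨M₃, g₁, g₂, nf.comm h⟩
    (hT _ _ _ _ _ _ _ huv hpq) h
  refine nf.closed e.restrict ?_
  have := indep_postcomp huv p
  rwa [nf.comm hpq] at this

theorem LeftTransitive.indep_mono_left (hT : nf.LeftTransitive) (hE : nf.Existence)
    (hU : nf.Uniqueness) {M₀ M₁ M₁' M₂ M₃ : C} {f₁ : M₀ ⟶ M₁} {f₂ : M₀ ⟶ M₂} {f : M₁ ⟶ M₁'}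
    {g₁ : M₁' ⟶ M₃} {g₂ : M₂ ⟶ M₃} (h : nf.Indep (f₁ ≫ f) f₂ g₁ g₂) :
    nf.Indep f₁ f₂ (f ≫ g₁) g₂ :=
  RightTransitive.indep_mono_right (nf := nf.dual) hT hE.dual hU.dual h

/-- Base monotonicity, in an extension of the ambient object. -/
theorem RightTransitive.exists_indep_base (hT : nf.RightTransitive) (hE : nf.Existence)
    (hU : nf.Uniqueness) {M₀ M₁ M₂ M₂' M₃ : C} {f₁ : M₀ ⟶ M₁} {f₂ : M₀ ⟶ M₂} {f : M₂ ⟶ M₂'}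
    {g₁ : M₁ ⟶ M₃} {g₂ : M₂' ⟶ M₃} (h : nf.Indep f₁ (f₂ ≫ f) g₁ g₂) :
    ∃ (P Q : C) (u : M₁ ⟶ P) (v : M₂ ⟶ P) (w : P ⟶ Q) (k : M₃ ⟶ Q),
      nf.Indep v f w (g₂ ≫ k) ∧ f₁ ≫ u = f₂ ≫ v ∧ g₁ ≫ k = u ≫ w := by
  -- The same two-step amalgam as for monotonicity: its second square has base `M₂`, and uniqueness
  -- maps it and `M₃` into a common extension.
  obtain ⟨P, u, v, huv⟩ := hE f₁ f₂
  obtain ⟨Q, p, q, hpq⟩ := hE v f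
  have e := hU ⟨Q, u ≫ p, q, nf.comm (hT _ _ _ _ _ _ _ huv hpq)⟩ ⟨M₃, g₁, g₂, nf.comm h⟩
    (hT _ _ _ _ _ _ _ huv hpq) h
  obtain ⟨N, x, y, h₁, h₂⟩ := e.equivStar hE
  dsimp only at h₁ h₂
  refine ⟨P, N, u, v, p ≫ x, y, ?_, nf.comm huv, ?_⟩
  · rw [← h₂]
    exact indep_postcomp hpq x
  · rw [← h₁, Category.assoc]

end IndepRel

end IndepRelBasics

/-! ### Directed unions of structures and of members of a `μ`-AEC -/

section Unions

variable {μ : Cardinal.{u}} {τ : Vocabulary μ}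

/-- Every subset of size less than `μ` has an upper bound. -/
def MuDirected (μ : Cardinal.{u}) (I : Type u) [PartialOrder I] : Prop :=
  ∀ S : Set I, #S < μ → BddAbove S

theorem MuDirected.exists_le_range {I : Type u} [PartialOrder I] (hI : MuDirected μ I)
    {A : Type u} (hA : #A < μ) (f : A → I) : ∃ k, ∀ a, f a ≤ k := by
  obtain ⟨k, hk⟩ := hI (Set.range f) (mk_range_le.trans_lt hA)
  exact ⟨k, fun a => hk ⟨a, rfl⟩⟩

theorem MuDirected.exists_ge_ge {I : Type u} [PartialOrder I] (hI : MuDirected μ I)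
    (hμ : μ.IsRegular) (i j : I) : ∃ k, i ≤ k ∧ j ≤ k := by
  obtain ⟨k, hk⟩ := hI {i, j} ((Set.toFinite _).lt_aleph0.trans_le hμ.aleph0_le)
  exact ⟨k, hk (by simp), hk (by simp)⟩

theorem MuDirected.nonempty {I : Type u} [PartialOrder I] (hI : MuDirected μ I)
    (hμ : μ.IsRegular) : Nonempty I := by
  obtain ⟨k, -⟩ := hI ∅ (by simpa using hμ.pos)
  exact ⟨k⟩

namespace Str

theorem hom_ext {M N : Str τ} {f g : M ⟶ N} (h : f.toFun = g.toFun) : f = g :=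
  Emb.ext h

/-- Factorization of an embedding through an embedding with larger range. -/
theorem exists_factor {M N P : Str τ} (f : M ⟶ P) (g : N ⟶ P)
    (h : Set.range f.toFun ⊆ Set.range g.toFun) : ∃ k : M ⟶ N, k ≫ g = f := by
  choose k hk using fun x => h ⟨x, rfl⟩
  refine ⟨⟨k, fun x y hxy => f.injective ?_, fun s x => g.injective ?_, fun r x => ?_⟩,
    hom_ext (funext hk)⟩
  · rw [← hk x, ← hk y, hxy]
  · rw [hk, f.map_fn, g.map_fn]
    exact congrArg _ (funext fun a => (hk _).symm)
  · rw [← g.map_rel, ← f.map_rel]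
    exact iff_of_eq (congrArg _ (funext fun a => hk _))

section Directed

variable {I : Type u} [PartialOrder I] (D : I ⥤ Str τ)

theorem map_map {i j k : I} (hij : i ≤ j) (hjk : j ≤ k) (x : (D.obj i).carrier) :
    (D.map (homOfLE hjk)).toFun ((D.map (homOfLE hij)).toFun x) =
      (D.map (homOfLE (hij.trans hjk))).toFun x := by
  rw [← homOfLE_comp hij hjk, D.map_comp]
  rfl

variable {D} in
theorem cocone_map (c : Cocone D) {i j : I} (hij : i ≤ j) (x : (D.obj i).carrier) :
    (c.ι.app j).toFun ((D.map (homOfLE hij)).toFun x) = (c.ι.app i).toFun x := by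
  rw [← c.w (homOfLE hij)]
  rfl

variable {D} in
/-- The union of the members of the cocone is everything. -/
def JointlySurjective (c : Cocone D) : Prop :=
  ∀ x : c.pt.carrier, ∃ i, x ∈ Set.range (c.ι.app i).toFun

variable {D} in
theorem JointlySurjective.exists_lift {c : Cocone D} (hc : JointlySurjective c)
    (hI : MuDirected μ I) {A : Type u} (hA : #A < μ) (x : A → c.pt.carrier) :
    ∃ (k : I) (y : A → (D.obj k).carrier), (c.ι.app k).toFun ∘ y = x := by
  choose i y hy using fun a => hc (x a)
  obtain ⟨k, hk⟩ := hI.exists_le_range hA i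
  refine ⟨k, fun a => (D.map (homOfLE (hk a))).toFun (y a), funext fun a => ?_⟩
  exact (cocone_map c (hk a) _).trans (hy a)

variable {D} in
theorem exists_desc (hμ : μ.IsRegular) {c : Cocone D} (hc : JointlySurjective c)
    (hI : MuDirected μ I) (c' : Cocone D) :
    ∃ h : c.pt ⟶ c'.pt, ∀ i, c.ι.app i ≫ h = c'.ι.app i := by
  choose p y hy using hc
  -- Whether two elements are identified is decided at a common later stage, since all cocone maps
  -- are injective. Hence the induced map is well defined and injective.
  have key : ∀ i j (x : (D.obj i).carrier) (x' : (D.obj j).carrier),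
      (c.ι.app i).toFun x = (c.ι.app j).toFun x' ↔
        (c'.ι.app i).toFun x = (c'.ι.app j).toFun x' := by
    intro i j x x'
    obtain ⟨k, hi, hj⟩ := hI.exists_ge_ge hμ i j
    rw [← cocone_map c hi, ← cocone_map c hj, ← cocone_map c' hi, ← cocone_map c' hj,
      (c.ι.app k).injective.eq_iff, (c'.ι.app k).injective.eq_iff]
  let h : c.pt.carrier → c'.pt.carrier := fun q => (c'.ι.app (p q)).toFun (y q)
  have hh : ∀ i x, h ((c.ι.app i).toFun x) = (c'.ι.app i).toFun x := fun i x =>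
    (key _ _ _ _).1 (hy _)
  refine ⟨⟨h, fun q q' hq => ?_, fun s x => ?_, fun r x => ?_⟩,
    fun i => hom_ext (funext (hh i))⟩
  · rw [← hy q, ← hy q']
    exact (key _ _ _ _).2 hq
  · obtain ⟨k, z, rfl⟩ := JointlySurjective.exists_lift (fun x => ⟨_, _, hy x⟩) hI
      (τ.fnArity_lt s) x
    refine (congrArg h ((c.ι.app k).map_fn s z).symm).trans ((hh k _).trans ?_)
    refine ((c'.ι.app k).map_fn s z).trans (congrArg (c'.pt.fn s) (funext fun a => ?_))
    exact (hh k _).symm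
  · obtain ⟨k, z, rfl⟩ := JointlySurjective.exists_lift (fun x => ⟨_, _, hy x⟩) hI
      (τ.relArity_lt r) x
    refine Iff.trans (iff_of_eq (congrArg (c'.pt.rel r) (funext fun a => hh k _)))
      (((c'.ι.app k).map_rel r z).trans ((c.ι.app k).map_rel r z).symm)

variable (hμ : μ.IsRegular) (hI : MuDirected μ I)

/-- Two elements of members of a directed system are identified when they agree later. -/
def unionSetoid : Setoid (Σ i, (D.obj i).carrier) where
  r p q := ∃ (k : I) (hp : p.1 ≤ k) (hq : q.1 ≤ k),
    (D.map (homOfLE hp)).toFun p.2 = (D.map (homOfLE hq)).toFun q.2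
  iseqv := by
    refine ⟨fun p => ⟨p.1, le_rfl, le_rfl, rfl⟩, fun ⟨k, hp, hq, h⟩ => ⟨k, hq, hp, h.symm⟩, ?_⟩
    rintro p q r ⟨k, hp, hq, h⟩ ⟨l, hq', hr, h'⟩
    obtain ⟨m, hk, hl⟩ := hI.exists_ge_ge hμ k l
    refine ⟨m, hp.trans hk, hr.trans hl, ?_⟩
    rw [← map_map D hp hk, h, map_map, ← map_map D hr hl, ← h', map_map]

/-- The elements of the union of a directed system of structures. -/
def Union : Type u := Quotient (unionSetoid D hμ hI)

variable {D} in
/-- The maps of the members into the union. -/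
def Union.mk (i : I) (x : (D.obj i).carrier) : Union D hμ hI :=
  Quotient.mk (unionSetoid D hμ hI) ⟨i, x⟩

theorem Union.mk_map {i j : I} (hij : i ≤ j) (x : (D.obj i).carrier) :
    Union.mk hμ hI j ((D.map (homOfLE hij)).toFun x) = Union.mk hμ hI i x :=
  Quotient.sound ⟨j, le_rfl, hij, map_map D hij le_rfl x⟩

theorem Union.exists_rep {A : Type u} (hA : #A < μ) (x : A → Union D hμ hI) :
    ∃ (k : I) (y : A → (D.obj k).carrier), x = Union.mk hμ hI k ∘ y := by
  choose p hp using fun a => Quotient.exists_rep (x a)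
  obtain ⟨k, hk⟩ := hI.exists_le_range hA fun a => (p a).1
  refine ⟨k, fun a => (D.map (homOfLE (hk a))).toFun (p a).2, funext fun a => ?_⟩
  exact ((Union.mk_map D hμ hI _ _).trans (hp a)).symm

theorem Union.exists_stage {A : Type u} (hA : #A < μ) {i j : I} (x : A → (D.obj i).carrier)
    (y : A → (D.obj j).carrier) (h : Union.mk hμ hI i ∘ x = Union.mk hμ hI j ∘ y) :
    ∃ (k : I) (hi : i ≤ k) (hj : j ≤ k),
      (D.map (homOfLE hi)).toFun ∘ x = (D.map (homOfLE hj)).toFun ∘ y := by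
  have h' : ∀ a, ∃ (k : I) (hp : i ≤ k) (hq : j ≤ k),
      (D.map (homOfLE hp)).toFun (x a) = (D.map (homOfLE hq)).toFun (y a) :=
    fun a => Quotient.exact (congrFun h a)
  choose k hi hj e using h'
  obtain ⟨m, hm⟩ := hI.exists_le_range hA k
  obtain ⟨m', him, hjm⟩ := hI.exists_ge_ge hμ i j
  obtain ⟨n, hmn, hmn'⟩ := hI.exists_ge_ge hμ m m'
  refine ⟨n, him.trans hmn', hjm.trans hmn', funext fun a => ?_⟩
  have := congrArg (D.map (homOfLE ((hm a).trans hmn))).toFun (e a)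
  rwa [map_map, map_map] at this

/-- The union of a directed system of structures. -/
noncomputable def unionStr : Str τ where
  carrier := Union D hμ hI
  fn s x :=
    let h := Union.exists_rep D hμ hI (τ.fnArity_lt s) x
    Union.mk hμ hI h.choose ((D.obj h.choose).fn s h.choose_spec.choose)
  rel r x := ∃ (k : I) (y : τ.relArity r → (D.obj k).carrier),
    x = Union.mk hμ hI k ∘ y ∧ (D.obj k).rel r y

/-- The maps of the members into the union are embeddings. -/
noncomputable def unionι (i : I) : D.obj i ⟶ unionStr D hμ hI where
  toFun := Union.mk hμ hI i
  injective x y h := by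
    obtain ⟨k, hi, hj, e⟩ : ∃ (k : I) (hp : i ≤ k) (hq : i ≤ k),
      (D.map (homOfLE hp)).toFun x = (D.map (homOfLE hq)).toFun y := Quotient.exact h
    exact (D.map _).injective e
  map_fn s x := by
    have h := Union.exists_rep D hμ hI (τ.fnArity_lt s) (Union.mk hμ hI i ∘ x)
    obtain ⟨m, hi, hk, e⟩ := Union.exists_stage D hμ hI (τ.fnArity_lt s) _ _
      h.choose_spec.choose_spec
    change _ = Union.mk hμ hI h.choose ((D.obj h.choose).fn s h.choose_spec.choose)
    rw [← Union.mk_map D hμ hI hi, ← Union.mk_map D hμ hI hk, (D.map _).map_fn,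
      (D.map _).map_fn, e]
  map_rel r x := by
    refine ⟨?_, fun h => ⟨i, x, rfl, h⟩⟩
    rintro ⟨k, y, h, hr⟩
    obtain ⟨m, hi, hk, e⟩ := Union.exists_stage D hμ hI (τ.relArity_lt r) _ _ h
    rwa [← (D.map (homOfLE hi)).map_rel, e, (D.map _).map_rel]

/-- The union as a cocone. -/
noncomputable def unionCocone : Cocone D where
  pt := unionStr D hμ hI
  ι :=
    { app := unionι D hμ hI
      naturality := fun _ _ f => hom_ext (funext fun x => Union.mk_map D hμ hI (leOfHom f) x) }

theorem unionCocone_jointlySurjective : JointlySurjective (unionCocone D hμ hI) := fun q =>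
  Quotient.inductionOn q fun p => ⟨p.1, p.2, rfl⟩

end Directed

end Str

namespace AbstractClass

variable {K : AbstractClass τ}

theorem fn_injective {M N : K.Obj} (f : M ⟶ N) : Function.Injective (fn f) := (Hom.emb f).injective

@[simp]
theorem fn_comp {M N P : K.Obj} (f : M ⟶ N) (g : N ⟶ P) : fn (f ≫ g) = fn g ∘ fn f := rfl

@[simp]
theorem fn_id (M : K.Obj) : fn (𝟙 M) = id := rfl

theorem hom_ext {M N : K.Obj} {f g : M ⟶ N} (h : fn f = fn g) : f = g :=
  Hom.ext (Str.hom_ext h)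

instance {M N : K.Obj} (f : M ⟶ N) : Mono f :=
  ⟨fun _ _ h => hom_ext ((fn_injective f).comp_left (congrArg fn h))⟩

theorem range_fn_comp_subset {M N P : K.Obj} (f : M ⟶ N) (g : N ⟶ P) :
    Set.range (fn (f ≫ g)) ⊆ Set.range (fn g) := by
  rintro _ ⟨x, rfl⟩
  exact ⟨fn f x, rfl⟩

/-- By coherence, containment of ranges is the only condition for factoring, so subobjects can be
handled as subsets. -/
theorem IsMuAEC.exists_factor (hK : K.IsMuAEC) {M N P : K.Obj} (f : M ⟶ P) (g : N ⟶ P)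
    (h : Set.range (fn f) ⊆ Set.range (fn g)) : ∃ k : M ⟶ N, k ≫ g = f := by
  obtain ⟨k, hk⟩ := Str.exists_factor (Hom.emb f) (Hom.emb g) h
  exact ⟨⟨k, hK.coherence k (Hom.emb g) (Hom.strong g) (hk ▸ Hom.strong f)⟩, Hom.ext hk⟩

section Directed

variable {I : Type u} [PartialOrder I] {D : I ⥤ K.Obj}

/-- The union of the members of the cocone is everything. -/
def JointlySurjective (c : Cocone D) : Prop :=
  ∀ x : c.pt.str.carrier, ∃ i, x ∈ Set.range (fn (c.ι.app i))

theorem IsMuAEC.exists_union (hK : K.IsMuAEC) (hμ : μ.IsRegular) (hI : MuDirected μ I)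
    (D : I ⥤ K.Obj) : ∃ c : Cocone D, JointlySurjective c := by
  have hs := Str.unionCocone_jointlySurjective (D ⋙ K.toStr) hμ hI
  obtain ⟨hm, hst, -⟩ := hK.chain I hI D (Str.unionCocone (D ⋙ K.toStr) hμ hI) hs
  refine ⟨⟨⟨_, hm⟩, ⟨fun i => ⟨_, hst i⟩, fun i j f => Hom.ext ?_⟩⟩, hs⟩
  exact (Str.unionCocone (D ⋙ K.toStr) hμ hI).ι.naturality f

theorem IsMuAEC.exists_desc (hK : K.IsMuAEC) (hμ : μ.IsRegular) (hI : MuDirected μ I)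
    {c : Cocone D} (hc : JointlySurjective c) (c' : Cocone D) :
    ∃ h : c.pt ⟶ c'.pt, ∀ i, c.ι.app i ≫ h = c'.ι.app i := by
  obtain ⟨h, hh⟩ := Str.exists_desc (c := K.toStr.mapCocone c) hμ hc hI (K.toStr.mapCocone c')
  refine ⟨⟨h, (hK.chain I hI D (K.toStr.mapCocone c) hc).2.2 _ h fun i => ?_⟩,
    fun i => Hom.ext (hh i)⟩
  rw [hh i]
  exact Hom.strong (c'.ι.app i)

theorem JointlySurjective.hom_ext {c : Cocone D} (hc : JointlySurjective c) {N : K.Obj}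
    {f g : c.pt ⟶ N} (h : ∀ i, c.ι.app i ≫ f = c.ι.app i ≫ g) : f = g := by
  refine AbstractClass.hom_ext (funext fun x => ?_)
  obtain ⟨i, y, rfl⟩ := hc x
  exact congrFun (congrArg fn (h i)) y

end Directed

end AbstractClass

end Unions

/-! ### Transfinite chains through ordinal labels -/

/-- The labels in use are bounded by some `b`; the remaining elements are labelled from `succ b` on,
along a well-order of `X`. -/
theorem Ordinal.exists_injective_extension {X : Type u} (R : Set X) (e : R → Ordinal.{u})
    (he : Function.Injective e) :
    ∃ e' : X → Ordinal.{u}, Function.Injective e' ∧ ∀ r : R, e' r = e r := by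
  classical
  obtain ⟨b, hb⟩ := Ordinal.bddAbove_of_small (s := Set.range e)
  have hb' : ∀ r : R, e r ≤ b := fun r => hb ⟨r, rfl⟩
  have hlt : ∀ (r : R) (x : X), e r < Order.succ b + Ordinal.typein WellOrderingRel x :=
    fun r x => (Order.lt_succ_of_le (hb' r)).trans_le le_self_add
  refine ⟨fun x => if h : x ∈ R then e ⟨x, h⟩ else
    Order.succ b + Ordinal.typein WellOrderingRel x, fun x y hxy => ?_, fun r => by simp⟩
  by_cases hx : x ∈ R <;> by_cases hy : y ∈ R <;> simp only [hx, hy, dite_true, dite_false] at hxy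
  · exact congrArg Subtype.val (he hxy)
  · exact absurd hxy (hlt _ _).ne
  · exact absurd hxy (hlt _ _).ne'
  · simpa using hxy

namespace AbstractClass

variable {μ : Cardinal.{u}} {τ : Vocabulary μ}

/-- A member of `K` whose elements are labelled by distinct ordinals. Such a member is identified
with a structure on a set of ordinals. -/
structure Labelled (K : AbstractClass τ) where
  obj : K.Obj
  label : obj.str.carrier → Ordinal.{u}
  injective : Function.Injective label

namespace Labelled

variable {K : AbstractClass τ}

-- Labels determine the embedding, so there is at most one inclusion between two labelled
-- structures. A monotone family is then automatically a functor, and a transfinite recursion need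
-- not carry compatibility of its maps.
instance : Preorder (Labelled K) where
  le p q := ∃ f : p.obj ⟶ q.obj, q.label ∘ fn f = p.label
  le_refl p := ⟨𝟙 _, rfl⟩
  le_trans p q r := fun ⟨f, hf⟩ ⟨g, hg⟩ =>
    ⟨f ≫ g, by rw [fn_comp, ← Function.comp_assoc, hg, hf]⟩

/-- The inclusion of labelled structures. -/
noncomputable def incl {p q : Labelled K} (h : p ≤ q) : p.obj ⟶ q.obj := h.choose

theorem label_incl {p q : Labelled K} (h : p ≤ q) : q.label ∘ fn (incl h) = p.label :=
  h.choose_spec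

theorem eq_incl {p q : Labelled K} (h : p ≤ q) (f : p.obj ⟶ q.obj)
    (hf : q.label ∘ fn f = p.label) : f = incl h :=
  hom_ext (q.injective.comp_left (hf.trans (label_incl h).symm))

@[simp]
theorem incl_incl {p q r : Labelled K} (h : p ≤ q) (h' : q ≤ r) :
    incl h ≫ incl h' = incl (h.trans h') :=
  eq_incl _ _ (by rw [fn_comp, ← Function.comp_assoc, label_incl, label_incl])

/-- The functor forgetting the labels. -/
noncomputable def forget : Labelled K ⥤ K.Obj where
  obj p := p.obj
  map h := incl (leOfHom h)
  map_id _ := (eq_incl _ _ rfl).symm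
  map_comp _ _ := (incl_incl _ _).symm

theorem exists_label (p : Labelled K) {N : K.Obj} (f : p.obj ⟶ N) :
    ∃ (q : Labelled K) (h : p ≤ q) (e : N ⟶ q.obj), f ≫ e = incl h := by
  choose y hy using fun r : Set.range (fn f) => r.2
  obtain ⟨l, hl, h⟩ := Ordinal.exists_injective_extension (Set.range (fn f)) (fun r => p.label (y r))
    fun r r' h => Subtype.ext (by rw [← hy r, ← hy r', p.injective h])
  have hpl : l ∘ fn f = p.label := funext fun x => by
    rw [Function.comp_apply, h ⟨_, x, rfl⟩, fn_injective f (hy ⟨_, x, rfl⟩)]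
  exact ⟨⟨N, l, hl⟩, ⟨f, hpl⟩, 𝟙 N, eq_incl _ _ hpl⟩

/-- Two elements of the chain have the same image in the bound exactly when they have the same
label. The labels therefore transfer to the union of the images and extend to the whole bound. -/
theorem exists_bound (hchain : K.HasChainBounds) {I : Type u} [LinearOrder I] [WellFoundedLT I]
    [Nonempty I] (g : I → Labelled K) (hg : Monotone g) : ∃ q, ∀ i, g i ≤ q := by
  obtain ⟨c⟩ := hchain I (hg.functor ⋙ forget)
  let m : ∀ i, (g i).obj ⟶ c.pt := fun i => c.ι.app i
  have hm : ∀ {i j} (h : i ≤ j), incl (hg h) ≫ m j = m i := fun h => c.w (homOfLE h)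
  have key : ∀ i j (x : (g i).obj.str.carrier) (y : (g j).obj.str.carrier),
      fn (m i) x = fn (m j) y ↔ (g i).label x = (g j).label y := by
    have : ∀ i j (_ : i ≤ j) (x : (g i).obj.str.carrier) (y : (g j).obj.str.carrier),
        fn (m i) x = fn (m j) y ↔ (g i).label x = (g j).label y := by
      intro i j h x y
      rw [← hm h, ← label_incl (hg h)]
      simp [(fn_injective (m j)).eq_iff, (g j).injective.eq_iff]
    intro i j x y
    rcases le_total i j with h | h
    · exact this i j h x y
    · rw [eq_comm, this j i h y x, eq_comm]
  choose i y hy using fun r : (⋃ i, Set.range (fn (m i)) : Set c.pt.str.carrier) =>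
    Set.mem_iUnion.1 r.2
  obtain ⟨l, hl, h⟩ := Ordinal.exists_injective_extension _ (fun r => (g (i r)).label (y r))
    fun r r' h => Subtype.ext (by rw [← hy r, ← hy r', (key _ _ _ _).2 h])
  refine ⟨⟨c.pt, l, hl⟩, fun j => ⟨m j, funext fun x => ?_⟩⟩
  exact (h ⟨_, Set.mem_iUnion.2 ⟨j, x, rfl⟩⟩).trans ((key _ _ _ _).1 (hy _))

/-- Transfinite construction of a chain of labelled structures: `g i` is a prescribed extension of
a bound `r i` of the earlier structures. -/
theorem exists_chain (hchain : K.HasChainBounds) (p₀ : Labelled K) (I : Type u) [LinearOrder I]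
    [WellFoundedLT I] (Good : Labelled K → Labelled K → Prop)
    (hgood : ∀ r, p₀ ≤ r → ∃ q, r ≤ q ∧ Good r q) :
    ∃ r g : I → Labelled K,
      ∀ i, p₀ ≤ r i ∧ (∀ j < i, g j ≤ r i) ∧ r i ≤ g i ∧ Good (r i) (g i) := by
  classical
  choose! s hs using hgood
  -- The pair `(p₀, p₀)` is a junk value; the induction at the end shows that the bound `r` always
  -- exists.
  let step (i : I) (prev : ∀ j, j < i → Labelled K × Labelled K) : Labelled K × Labelled K :=
    if h : ∃ r, p₀ ≤ r ∧ ∀ j hj, (prev j hj).2 ≤ r then (h.choose, s h.choose) else (p₀, p₀)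
  let F : I → Labelled K × Labelled K := (wellFounded_lt (α := I)).fix step
  have hF : ∀ i, F i = step i fun j _ => F j := fun i => WellFounded.fix_eq _ _ _
  have hstep : ∀ i, (∃ r, p₀ ≤ r ∧ ∀ j < i, (F j).2 ≤ r) →
      p₀ ≤ (F i).1 ∧ (∀ j < i, (F j).2 ≤ (F i).1) ∧ (F i).1 ≤ (F i).2 ∧ Good (F i).1 (F i).2 := by
    intro i h
    have e : F i = (h.choose, s h.choose) := (hF i).trans (dif_pos h)
    rw [e]
    exact ⟨h.choose_spec.1, h.choose_spec.2, hs _ h.choose_spec.1⟩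
  refine ⟨fun i => (F i).1, fun i => (F i).2, fun i => hstep i ?_⟩
  induction i using WellFoundedLT.induction with
  | ind i ih =>
    rcases isEmpty_or_nonempty (Set.Iio i) with hi | hi
    · exact ⟨p₀, le_rfl, fun j hj => hi.elim ⟨j, hj⟩⟩
    have hmono : Monotone fun j : Set.Iio i => (F j).2 := by
      intro j k hjk
      rcases hjk.eq_or_lt with rfl | h
      · exact le_rfl
      · obtain ⟨-, h₁, h₂, -⟩ := hstep k (ih k k.2)
        exact (h₁ j h).trans h₂
    obtain ⟨q, hq⟩ := exists_bound hchain _ hmono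
    obtain ⟨j⟩ := hi
    obtain ⟨h₁, -, h₂, -⟩ := hstep j (ih j j.2)
    exact ⟨q, (h₁.trans h₂).trans (hq j), fun k hk => hq ⟨k, hk⟩⟩

end Labelled

end AbstractClass

/-! ### Symmetry from local character -/

theorem MuDirected.of_isCardinalFiltered {κ : Cardinal.{u}} [Fact κ.IsRegular] (I : Type u)
    [PartialOrder I] [IsCardinalFiltered I κ] : MuDirected κ I := by
  intro S hS
  have hlt : HasCardinalLT S κ := (hasCardinalLT_iff_cardinal_mk_lt _ _).2 hS
  exact ⟨IsCardinalFiltered.max (κ := κ) (fun s : S => (s : I)) hlt,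
    fun s hs => leOfHom (IsCardinalFiltered.toMax (fun s : S => (s : I)) hlt ⟨s, hs⟩)⟩

theorem muDirected_ord_toType {δ : Cardinal.{u}} (hδ : δ.IsRegular) :
    MuDirected δ δ.ord.ToType :=
  have : Fact δ.IsRegular := ⟨hδ⟩
  MuDirected.of_isCardinalFiltered _

namespace IndepRel

open AbstractClass

variable {μ : Cardinal.{u}} {τ : Vocabulary μ} {K : AbstractClass τ} {nf : IndepRel K.Obj}

/-- A small subset of a directed union is contained in one of the members. -/
theorem exists_factor_of_jointlySurjective (hK : K.IsMuAEC) {κ : Cardinal.{u}} {I : Type u}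
    [PartialOrder I] (hI : MuDirected κ I) {D : I ⥤ K.Obj} {c : Cocone D}
    (hc : JointlySurjective c) {A : K.Obj} (hA : #A.str.carrier < κ) (f : A ⟶ c.pt) :
    ∃ (i : I) (k : A ⟶ D.obj i), k ≫ c.ι.app i = f := by
  choose i y hy using fun a => hc (fn f a)
  obtain ⟨k, hk⟩ := hI.exists_le_range hA i
  obtain ⟨g, hg⟩ := hK.exists_factor f (c.ι.app k) (by
    rintro _ ⟨a, rfl⟩
    refine ⟨fn (D.map (homOfLE (hk a))) (y a), ?_⟩
    have := congrFun (congrArg fn (c.w (homOfLE (hk a)))) (y a)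
    exact this.trans (hy a))
  exact ⟨k, g, hg⟩

/-- The model on the right that witnesses the closure contains `U`, so right monotonicity shrinks it
to `U` itself. -/
theorem Closure.exists_indep (hK : K.IsMuAEC) (hT : nf.RightTransitive) (hE : nf.Existence)
    (hU : nf.Uniqueness) {A U W : K.Obj} {k : A ⟶ U} {i : U ⟶ W} {S : Set W.str.carrier}
    (h : nf.Closure (k ≫ i) S (Set.range (fn i))) :
    ∃ (P Q : K.Obj) (w : W ⟶ Q) (p : A ⟶ P) (q : P ⟶ Q),
      nf.Indep p k q (i ≫ w) ∧ fn w '' S ⊆ Set.range (fn q) := by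
  obtain ⟨M₁, M₂, M₃, j, f₁, f₂, g₁, g₂, hI, hc, h₁, h₂⟩ := h
  rw [← Set.range_comp, ← fn_comp] at h₂
  obtain ⟨s, hs⟩ := hK.exists_factor _ _ h₂
  have e : f₂ = k ≫ s := by
    rw [← cancel_mono g₂, ← nf.comm hI, hc, Category.assoc, Category.assoc, hs]
  subst e
  refine ⟨M₁, M₃, j, f₁, g₁, ?_, h₁⟩
  rw [← hs]
  exact hT.indep_mono_right hE hU hI

theorem symmetric_of_rightLocalCharacter (hμ : μ.IsRegular) (hK : K.IsMuAEC)
    (hchain : K.HasChainBounds) (htrans : nf.Transitive) (hE : nf.Existence)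
    (hU : nf.Uniqueness) (hlc : nf.RightLocalCharacter) {M₀ M₁ M₂ M₃ : K.Obj} {f₁ : M₀ ⟶ M₁}
    {f₂ : M₀ ⟶ M₂} {g₁ : M₁ ⟶ M₃} {g₂ : M₂ ⟶ M₃} (h : nf.Indep f₁ f₂ g₁ g₂) :
    nf.Indep f₂ f₁ g₂ g₁ := by
  obtain ⟨hL, hR⟩ := htrans
  obtain ⟨lam, hlam⟩ := hlc #M₂.str.carrier
  -- `μ ≤ δ` makes the chain `μ`-directed, so that its union lies in `K`; `lam < δ` puts every
  -- submodel of size at most `lam` inside one stage.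
  obtain ⟨δ, hδ, hμδ, hlamδ⟩ : ∃ δ : Cardinal.{u}, δ.IsRegular ∧ μ ≤ δ ∧ lam < δ :=
    ⟨Order.succ (μ ⊔ lam), isRegular_succ (hμ.aleph0_le.trans le_sup_left),
      le_sup_left.trans (Order.le_succ _), Order.lt_succ_of_le le_sup_right⟩
  have hdir := muDirected_ord_toType hδ
  -- The chain of independent copies of `M₁`.
  obtain ⟨l₀, hl₀, -⟩ := Ordinal.exists_injective_extension (X := M₀.str.carrier) ∅
    (fun x => x.2.elim) (fun x => x.2.elim)
  let p₀ : Labelled K := ⟨M₀, l₀, hl₀⟩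
  obtain ⟨r, g, hrg⟩ := Labelled.exists_chain hchain p₀ δ.ord.ToType
    (fun r q => ∃ (h₀ : p₀ ≤ r) (h : r ≤ q) (v : M₁ ⟶ q.obj),
      nf.Indep (Labelled.incl h₀) f₁ (Labelled.incl h) v) (by
    intro r h₀
    obtain ⟨P, u, v, huv⟩ := hE (Labelled.incl h₀) f₁
    obtain ⟨q, hq, e, he⟩ := r.exists_label u
    exact ⟨q, hq, h₀, hq, v ≫ e, he ▸ indep_postcomp huv e⟩)
  have hmono : Monotone g := by
    intro j k hjk
    rcases hjk.eq_or_lt with rfl | h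
    · exact le_rfl
    · exact ((hrg k).2.1 j h).trans (hrg k).2.2.1
  obtain ⟨c, hc⟩ := hK.exists_union hμ (fun S hS => hdir S (hS.trans_le hμδ))
    (hmono.functor ⋙ Labelled.forget)
  let ι : ∀ i, (g i).obj ⟶ c.pt := fun i => c.ι.app i
  have hι : ∀ {i j} (h : i ≤ j), Labelled.incl (hmono h) ≫ ι j = ι i := fun h => c.w (homOfLE h)
  have hg₀ : ∀ i, p₀ ≤ g i := fun i => (hrg i).1.trans (hrg i).2.2.1
  have hbase : ∀ i j, Labelled.incl (hg₀ i) ≫ ι i = Labelled.incl (hg₀ j) ≫ ι j := by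
    have : ∀ i j, i ≤ j → Labelled.incl (hg₀ i) ≫ ι i = Labelled.incl (hg₀ j) ≫ ι j := by
      intro i j hij
      rw [← hι hij, ← Category.assoc, Labelled.incl_incl]
    intro i j
    rcases le_total i j with h | h
    · exact this i j h
    · exact (this j i h).symm
  obtain ⟨i₀⟩ := hdir.nonempty hδ
  -- A copy of `M₂` such that the union of the chain is independent of it.
  obtain ⟨W, x, a, hxa⟩ := hE (Labelled.incl (hg₀ i₀) ≫ ι i₀) f₂
  obtain ⟨A, k, hA, hcl⟩ := hlam c.pt W x _ (fn a) rfl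
  obtain ⟨P, Q, w, p, q, hpk, hS⟩ := hcl.exists_indep hK hR hE hU
  rw [← Set.range_comp, ← fn_comp] at hS
  obtain ⟨t, ht⟩ := hK.exists_factor _ _ hS
  obtain ⟨j, k', hk'⟩ : ∃ (j : _) (k' : A ⟶ (g j).obj), k' ≫ ι j = k :=
    exists_factor_of_jointlySurjective hK hdir hc (hA.trans_lt hlamδ) k
  -- A strictly later index, so that the base `A` lies in `r i`, before the copy of `M₁` in `g i` is
  -- added.
  obtain ⟨i, hi⟩ : ∃ i, j < i := by
    have := noMaxOrder hδ.aleph0_le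
    exact exists_gt j
  obtain ⟨-, hr, hrg', h₀, hle, v, hv⟩ := hrg i
  have hk : k = (k' ≫ Labelled.incl (hr j hi)) ≫ Labelled.incl hle ≫ ι i := by
    rw [← hk', Category.assoc, ← Category.assoc (Labelled.incl _), Labelled.incl_incl, hι hi.le]
  rw [hk] at hpk
  -- The base is raised from `A` to `r i`. The new left side `P'` contains both `r i` and the copy
  -- of `M₂`.
  obtain ⟨P', Q', b, d, e, y, hd, -, hbe⟩ := hR.exists_indep_base hE hU hpk
  have hbase' : Labelled.incl h₀ ≫ Labelled.incl hle ≫ ι i = Labelled.incl (hg₀ i₀) ≫ ι i₀ := by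
    rw [← hbase i, ← Category.assoc, Labelled.incl_incl]
  have hb : Labelled.incl h₀ ≫ d = f₂ ≫ t ≫ b := by
    have h1 := nf.comm hd
    have h2 := nf.comm hxa
    rw [← cancel_mono e]
    simp only [Category.assoc] at h1 h2 hbase' ⊢
    rw [h1, ← hbe, reassoc_of% ht, ← reassoc_of% h2, ← reassoc_of% hbase']
  -- `r i` is independent from the copy of `M₁` over `M₀`, and `P'` from `g i` over `r i`. Left
  -- transitivity composes these, and left monotonicity shrinks `P'` to `M₂`.
  have h21 : nf.Indep f₂ f₁ (a ≫ w ≫ y) (v ≫ ι i ≫ (x ≫ w) ≫ y) := by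
    have := hL _ _ _ _ _ _ _ hv (hR.indep_mono_right hE hU hd)
    change nf.Indep (Labelled.incl h₀ ≫ d) f₁ e _ at this
    rw [hb] at this
    have := hL.indep_mono_left hE hU this
    rw [Category.assoc, ← hbe, reassoc_of% ht] at this
    simpa only [Category.assoc] using this
  -- The opposite order holds because the whole union, which contains this copy of `M₁`, was
  -- amalgamated on the left of `M₂`.
  have h12 : nf.Indep f₁ f₂ (v ≫ ι i ≫ (x ≫ w) ≫ y) (a ≫ w ≫ y) := by
    have hcv : f₁ ≫ v ≫ ι i = Labelled.incl (hg₀ i₀) ≫ ι i₀ := by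
      rw [← hbase', reassoc_of% nf.comm hv]
    rw [← hcv] at hxa
    have := indep_postcomp (hL.indep_mono_left hE hU hxa) (w ≫ y)
    simpa only [Category.assoc] using this
  exact nf.closed (hU ⟨_, _, _, nf.comm h12⟩ ⟨_, _, _, nf.comm h⟩ h12 h).swap h21

end IndepRel

/-! ### Directed colimits and presentable objects in the category of independent squares -/

namespace IndepRel

open AbstractClass

variable {μ : Cardinal.{u}} {τ : Vocabulary μ} {K : AbstractClass τ} {nf : IndepRel K.Obj}

theorem _root_.MuDirected.mono {μ κ : Cardinal.{u}} (h : μ ≤ κ) {I : Type u} [PartialOrder I]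
    (hI : MuDirected κ I) : MuDirected μ I := fun S hS => hI S (hS.trans_le h)

theorem _root_.AbstractClass.JointlySurjective.exists_subset_range {κ : Cardinal.{u}}
    (hκ : κ.IsRegular) {I : Type u} [PartialOrder I] (hI : MuDirected κ I) {D : I ⥤ K.Obj}
    {c : Cocone D} (hc : JointlySurjective c) {S : Set c.pt.str.carrier} (hS : #S < κ) (i : I) :
    ∃ j, i ≤ j ∧ S ⊆ Set.range (fn (c.ι.app j)) := by
  choose k y hy using fun a : S => hc a
  obtain ⟨l, hl⟩ := hI.exists_le_range hS k
  obtain ⟨j, hij, hlj⟩ := hI.exists_ge_ge hκ i l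
  refine ⟨j, hij, fun a ha => ⟨fn (D.map (homOfLE ((hl ⟨a, ha⟩).trans hlj))) (y ⟨a, ha⟩), ?_⟩⟩
  exact (congrFun (congrArg fn (c.w _)) _).trans (hy ⟨a, ha⟩)

theorem Closure.symm (hsym : nf.Symmetric) {N₀ N₃ : K.Obj} {i : N₀ ⟶ N₃}
    {A B : Set N₃.str.carrier} (h : nf.Closure i A B) : nf.Closure i B A := by
  obtain ⟨M₁, M₂, M₃, j, f₁, f₂, g₁, g₂, hI, hc, h₁, h₂⟩ := h
  refine ⟨M₂, M₁, M₃, j, f₂, f₁, g₂, g₁, ?_, (nf.comm hI).symm.trans hc, h₂, h₁⟩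
  rw [hsym] at hI
  exact hI

theorem Symmetric.swap (hsym : nf.Symmetric) {M₀ M₁ M₂ M₃ : K.Obj} {f₁ : M₀ ⟶ M₁} {f₂ : M₀ ⟶ M₂}
    {g₁ : M₁ ⟶ M₃} {g₂ : M₂ ⟶ M₃} (h : nf.Indep f₁ f₂ g₁ g₂) : nf.Indep f₂ f₁ g₂ g₁ := by
  rw [hsym] at h
  exact h

/-- Base monotonicity in terms of the closure. -/
theorem Closure.of_indep (hT : nf.RightTransitive) (hE : nf.Existence) (hU : nf.Uniqueness)
    {A B M N Q : K.Obj} {k : A ⟶ B} {f : B ⟶ M} {i : M ⟶ N} {j : N ⟶ Q} {P : K.Obj} {p : A ⟶ P}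
    {q : P ⟶ Q} (h : nf.Indep p (k ≫ f) q (i ≫ j)) {S : Set N.str.carrier}
    (hS : fn j '' S ⊆ Set.range (fn q)) : nf.Closure (f ≫ i) S (Set.range (fn i)) := by
  obtain ⟨P', Q', u, v, w, y, hv, -, hq⟩ := hT.exists_indep_base hE hU h
  refine ⟨P', M, Q', j ≫ y, v, f, w, (i ≫ j) ≫ y, hv, ?_, ?_, ?_⟩
  · rw [nf.comm hv]
    simp only [Category.assoc]
  · rw [fn_comp, Set.image_comp]
    refine (Set.image_mono hS).trans ?_
    rw [← Set.range_comp, ← fn_comp, hq]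
    exact range_fn_comp_subset _ _
  · rw [← Set.range_comp, ← fn_comp, Category.assoc]

theorem Closure.base_mono (hK : K.IsMuAEC) (hT : nf.RightTransitive) (hE : nf.Existence)
    (hU : nf.Uniqueness) {A B M N : K.Obj} {k : A ⟶ B} {f : B ⟶ M} {i : M ⟶ N}
    {S : Set N.str.carrier} (h : nf.Closure ((k ≫ f) ≫ i) S (Set.range (fn i))) :
    nf.Closure (f ≫ i) S (Set.range (fn i)) := by
  obtain ⟨P, Q, j, p, q, hI, hS⟩ := h.exists_indep hK hT hE hU
  exact Closure.of_indep hT hE hU hI hS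

namespace NF

variable {hT : nf.RightTransitive} {hE : nf.Existence}

/-- The functor sending a morphism to its source. -/
def sourceFunctor : nf.NF hT hE ⥤ K.Obj where
  obj f := f.source
  map a := Hom.bot a

/-- The functor sending a morphism to its target. -/
def targetFunctor : nf.NF hT hE ⥤ K.Obj where
  obj f := f.target
  map a := Hom.top a

theorem hom_ext {X Y : nf.NF hT hE} {a b : X ⟶ Y} (h₁ : Hom.bot a = Hom.bot b)
    (h₂ : Hom.top a = Hom.top b) : a = b := Hom.ext h₁ h₂

instance {X Y : nf.NF hT hE} (a : X ⟶ Y) : Mono a :=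
  ⟨fun _ _ h => hom_ext ((cancel_mono (Hom.bot a)).1 (congrArg Hom.bot h))
    ((cancel_mono (Hom.top a)).1 (congrArg Hom.top h))⟩

/-- Right monotonicity shrinks the right side from the source of `Z` to that of `Y`, and the ambient
object may then be shrunk to the target of `Y`. Subobjects of an object are thus compared by their
ranges. -/
theorem exists_factor (hK : K.IsMuAEC) (hU : nf.Uniqueness) {X Y Z : nf.NF hT hE} (a : X ⟶ Z)
    (b : Y ⟶ Z) (h₁ : Set.range (fn (Hom.bot a)) ⊆ Set.range (fn (Hom.bot b)))
    (h₂ : Set.range (fn (Hom.top a)) ⊆ Set.range (fn (Hom.top b))) : ∃ c : X ⟶ Y, c ≫ b = a := by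
  obtain ⟨s, hs⟩ := hK.exists_factor _ _ h₁
  obtain ⟨t, ht⟩ := hK.exists_factor _ _ h₂
  have hb := nf.comm (Hom.indep b)
  have ha := Hom.indep a
  rw [← hs, ← ht] at ha
  have h := hT.indep_mono_right hE hU ha
  rw [← hb] at h
  refine ⟨⟨s, t, indep_of_postcomp ?_ _ h⟩, hom_ext hs ht⟩
  rw [← cancel_mono (Hom.top b)]
  simpa only [Category.assoc] using nf.comm h

variable {κ θ : Cardinal.{u}} {I : Type u} [PartialOrder I] {D : I ⥤ nf.NF hT hE}

/-- Fewer than `θ` elements of the union of the sources already lie in one source `j ≥ i`, where the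
transition square from `i` to `j` is independent. The witness property passes to the whole union. -/
theorem indep_ι (hκ : κ.IsRegular) (hθ : θ ≤ κ) (hw : nf.RightWitnessPropertyAt θ)
    (hI : MuDirected κ I) {s : Cocone (D ⋙ sourceFunctor)} (hs : JointlySurjective s)
    {t : Cocone (D ⋙ targetFunctor)} {f : s.pt ⟶ t.pt}
    (hf : ∀ i, (D.obj i).map ≫ t.ι.app i = s.ι.app i ≫ f) (i : I) :
    nf.Indep (D.obj i).map (s.ι.app i) (t.ι.app i) f := by
  refine hw _ _ _ _ (hf i) fun A hA => ?_
  obtain ⟨j, hij, hj⟩ := hs.exists_subset_range hκ hI (hA.trans_le hθ) i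
  have h := indep_postcomp (Hom.indep (D.map (homOfLE hij))) (t.ι.app j)
  rw [hf j, show Hom.top (D.map (homOfLE hij)) ≫ t.ι.app j = t.ι.app i from t.w (homOfLE hij)] at h
  refine ⟨_, _, _, 𝟙 _, _, _, _, _, h, (Category.comp_id _).symm, ?_, ?_⟩
  · simp
  · rw [fn_id, Set.image_id]
    exact (Set.image_mono hj).trans (Set.range_comp (fn f) _).superset

/-- Here the directed union is on the left, so symmetry is needed to apply the right witness
property. A small part of `t.pt` lies in one target, and base monotonicity raises the base from its
source to `s.pt`. -/
theorem indep_desc (hsym : nf.Symmetric) (hU : nf.Uniqueness) (hκ : κ.IsRegular)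
    (hθ : θ ≤ κ) (hw : nf.RightWitnessPropertyAt θ) (hI : MuDirected κ I)
    {s : Cocone (D ⋙ sourceFunctor)} {t : Cocone (D ⋙ targetFunctor)} (ht : JointlySurjective t)
    {f : s.pt ⟶ t.pt} {X Y : K.Obj} {x : X ⟶ Y} {a : s.pt ⟶ X} {b : t.pt ⟶ Y}
    (hc : f ≫ b = a ≫ x)
    (h : ∀ i, nf.Indep (D.obj i).map (s.ι.app i ≫ a) (t.ι.app i ≫ b) x) : nf.Indep f a b x := by
  refine hsym.swap (hw _ _ _ _ hc.symm fun A hA => ?_)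
  obtain ⟨i₀⟩ := hI.nonempty hκ
  obtain ⟨i, -, hi⟩ := ht.exists_subset_range hκ hI (hA.trans_le hθ) i₀
  have hi' := h i
  rw [← Category.comp_id x] at hi'
  refine Closure.symm hsym (Closure.of_indep hT hE hU hi' ?_)
  rw [fn_id, Set.image_id]
  exact (Set.image_mono hi).trans (Set.range_comp (fn b) _).superset

/-- A jointly surjective cocone over a sufficiently directed diagram of independent squares is a
colimit cocone. -/
theorem nonempty_isColimit (hμ : μ.IsRegular) (hK : K.IsMuAEC) (hsym : nf.Symmetric)
    (hU : nf.Uniqueness) (hκ : κ.IsRegular) (hμκ : μ ≤ κ) (hθ : θ ≤ κ)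
    (hw : nf.RightWitnessPropertyAt θ) (hI : MuDirected κ I) {c : Cocone D}
    (hs : JointlySurjective (sourceFunctor.mapCocone c))
    (ht : JointlySurjective (targetFunctor.mapCocone c)) : Nonempty (IsColimit c) := by
  have hI' := hI.mono hμκ
  have key : ∀ c' : Cocone D, ∃ h : c.pt ⟶ c'.pt, ∀ i, c.ι.app i ≫ h = c'.ι.app i := by
    intro c'
    obtain ⟨a, ha⟩ := hK.exists_desc hμ hI' hs (sourceFunctor.mapCocone c')
    obtain ⟨b, hb⟩ := hK.exists_desc hμ hI' ht (targetFunctor.mapCocone c')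
    have hi : ∀ i, nf.Indep (D.obj i).map (Hom.bot (c.ι.app i) ≫ a) (Hom.top (c.ι.app i) ≫ b)
        c'.pt.map := by
      intro i
      have h := Hom.indep (c'.ι.app i)
      rw [← show _ = Hom.bot (c'.ι.app i) from ha i,
        ← show _ = Hom.top (c'.ι.app i) from hb i] at h
      exact h
    refine ⟨⟨a, b, ?_⟩, fun i => hom_ext (ha i) (hb i)⟩
    refine indep_desc hsym hU hκ hθ hw hI (s := sourceFunctor.mapCocone c) ht ?_ hi
    refine hs.hom_ext fun i => ?_
    have h₂ := nf.comm (Hom.indep (c.ι.app i))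
    exact (((Category.assoc _ _ _).symm.trans (congrArg (· ≫ b) h₂.symm)).trans
      (Category.assoc _ _ _)).trans ((nf.comm (hi i)).trans (Category.assoc _ _ _))
  choose d hd using key
  refine ⟨⟨d, hd, fun c' m hm => hom_ext (hs.hom_ext fun i => ?_) (ht.hom_ext fun i => ?_)⟩⟩
  · exact congrArg Hom.bot ((hm i).trans (hd c' i).symm)
  · exact congrArg Hom.top ((hm i).trans (hd c' i).symm)

theorem exists_jointlySurjective (hμ : μ.IsRegular) (hK : K.IsMuAEC) (hκ : κ.IsRegular)
    (hμκ : μ ≤ κ) (hθ : θ ≤ κ) (hw : nf.RightWitnessPropertyAt θ) (hI : MuDirected κ I)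
    (D : I ⥤ nf.NF hT hE) : ∃ c : Cocone D, JointlySurjective (sourceFunctor.mapCocone c) ∧
      JointlySurjective (targetFunctor.mapCocone c) := by
  have hI' := hI.mono hμκ
  obtain ⟨s, hs⟩ := hK.exists_union hμ hI' (D ⋙ sourceFunctor)
  obtain ⟨t, ht⟩ := hK.exists_union hμ hI' (D ⋙ targetFunctor)
  obtain ⟨f, hf⟩ := hK.exists_desc hμ hI' hs ⟨t.pt,
    { app := fun i => (D.obj i).map ≫ t.ι.app i
      naturality := fun i j a => by
        have h := nf.comm (Hom.indep (D.map a))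
        have h' : Hom.top (D.map a) ≫ t.ι.app j = t.ι.app i := t.w a
        change Hom.bot (D.map a) ≫ (D.obj j).map ≫ t.ι.app j = ((D.obj i).map ≫ t.ι.app i) ≫ 𝟙 _
        rw [Category.comp_id, ← h']
        exact ((Category.assoc _ _ _).symm.trans (congrArg (· ≫ t.ι.app j) h.symm)).trans
          (Category.assoc _ _ _) }⟩
  refine ⟨⟨⟨f⟩, ⟨fun i => ⟨s.ι.app i, t.ι.app i,
    indep_ι hκ hθ hw hI hs (fun i => (hf i).symm) i⟩, fun i j a => hom_ext ?_ ?_⟩⟩, hs, ht⟩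
  · exact s.ι.naturality a
  · exact t.ι.naturality a

end NF

end IndepRel

theorem MuDirected.isCardinalFiltered {κ : Cardinal.{u}} [Fact κ.IsRegular] {I : Type u}
    [PartialOrder I] (hI : MuDirected κ I) : IsCardinalFiltered I κ :=
  isCardinalFiltered_preorder I κ fun _ s hs => hI.exists_le_range hs s

namespace IndepRel

open AbstractClass

variable {μ : Cardinal.{u}} {τ : Vocabulary μ} {K : AbstractClass τ} {nf : IndepRel K.Obj}

namespace NF

variable {hT : nf.RightTransitive} {hE : nf.Existence}

theorem hasCardinalFilteredColimits {θ : Cardinal.{u}} (hμ : μ.IsRegular) (hK : K.IsMuAEC)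
    (hsym : nf.Symmetric) (hU : nf.Uniqueness) (κ : Cardinal.{u}) [hκ : Fact κ.IsRegular]
    (hμκ : μ ≤ κ) (hθ : θ ≤ κ) (hw : nf.RightWitnessPropertyAt θ) :
    HasCardinalFilteredColimits (nf.NF hT hE) κ where
  hasColimitsOfShape J _ _ := by
    -- A final functor from a directed poset reduces filtered colimits to directed unions.
    obtain ⟨α, _, _, F, _⟩ := IsCardinalFiltered.exists_cardinal_directed J κ
    have : HasColimitsOfShape α (nf.NF hT hE) := ⟨fun D => by
      have hα := MuDirected.of_isCardinalFiltered (κ := κ) α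
      obtain ⟨c, hs, ht⟩ := exists_jointlySurjective hμ hK hκ.out hμκ hθ hw hα D
      obtain ⟨hc⟩ := nonempty_isColimit hμ hK hsym hU hκ.out hμκ hθ hw hα hs ht
      exact ⟨⟨c, hc⟩⟩⟩
    exact Functor.Final.hasColimitsOfShape_of_final F

/-- Morphisms between small objects are presentable. -/
theorem isCardinalPresentable {θ : Cardinal.{u}} (hμ : μ.IsRegular) (hK : K.IsMuAEC)
    (hsym : nf.Symmetric) (hU : nf.Uniqueness) (κ : Cardinal.{u}) [hκ : Fact κ.IsRegular]
    (hμκ : μ ≤ κ) (hθ : θ ≤ κ) (hw : nf.RightWitnessPropertyAt θ) (X : nf.NF hT hE)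
    (h₁ : #X.source.str.carrier < κ) (h₂ : #X.target.str.carrier < κ) :
    IsCardinalPresentable X κ where
  preservesColimitOfShape J _ _ := by
    obtain ⟨α, _, _, F, _⟩ := IsCardinalFiltered.exists_cardinal_directed J κ
    have : PreservesColimitsOfShape α (coyoneda.obj (Opposite.op X)) := ⟨fun {D} => by
      have hα := MuDirected.of_isCardinalFiltered (κ := κ) α
      obtain ⟨c, hs, ht⟩ := exists_jointlySurjective hμ hK hκ.out hμκ hθ hw hα D
      obtain ⟨hc⟩ := nonempty_isColimit hμ hK hsym hU hκ.out hμκ hθ hw hα hs ht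
      refine preservesColimit_of_preserves_colimit_cocone hc
        (Types.FilteredColimit.isColimitOf _ _ (fun x => ?_) fun i j x y hxy => ?_)
      -- Source and target of `X` both fit into one stage, and range containment gives the
      -- factorization. Its essential uniqueness in the other goal follows because all morphisms are
      -- monic.
      · obtain ⟨i⟩ := hα.nonempty hκ.out
        obtain ⟨j, -, hj⟩ := hs.exists_subset_range hκ.out hα
          (mk_range_le.trans_lt h₁ : #(Set.range (fn (Hom.bot x))) < κ) i
        obtain ⟨k, hjk, hk⟩ := ht.exists_subset_range hκ.out hα
          (mk_range_le.trans_lt h₂ : #(Set.range (fn (Hom.top x))) < κ) j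
        have hj' : Set.range (fn (Hom.bot (c.ι.app j))) ⊆ Set.range (fn (Hom.bot (c.ι.app k))) := by
          rw [← c.w (homOfLE hjk)]
          exact range_fn_comp_subset (Hom.bot (D.map (homOfLE hjk))) (Hom.bot (c.ι.app k))
        obtain ⟨y, hy⟩ := exists_factor hK hU (x : X ⟶ c.pt) (c.ι.app k) (hj.trans hj') hk
        exact ⟨k, y, hy.symm⟩
      · obtain ⟨k, hik, hjk⟩ := hα.exists_ge_ge hκ.out i j
        refine ⟨k, homOfLE hik, homOfLE hjk, ?_⟩
        have hxy' : (x : X ⟶ D.obj i) ≫ c.ι.app i = (y : X ⟶ D.obj j) ≫ c.ι.app j := hxy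
        rw [← c.w (homOfLE hik), ← c.w (homOfLE hjk), ← Category.assoc, ← Category.assoc] at hxy'
        exact (cancel_mono (c.ι.app k)).1 hxy'⟩
    exact Functor.Final.preservesColimitsOfShape_of_final F _

end NF

end IndepRel

/-! ### Essential smallness of the class of small objects -/

namespace AbstractClass

variable {μ : Cardinal.{u}} {τ : Vocabulary μ}

/-- The members of `K` whose universe is a subset of `Λ`. -/
def ObjOn (K : AbstractClass τ) (Λ : Type u) : Type u :=
  {p : Σ S : Set Λ, (∀ s, (τ.fnArity s → S) → S) × (∀ r, (τ.relArity r → S) → Prop) //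
    K.mem ⟨p.1, p.2.1, p.2.2⟩}

/-- The object of `K` given by a structure on a subset of `Λ`. -/
def ObjOn.toObj {K : AbstractClass τ} {Λ : Type u} (p : K.ObjOn Λ) : K.Obj :=
  ⟨⟨p.1.1, p.1.2.1, p.1.2.2⟩, p.2⟩

theorem exists_objOn_iso {K : AbstractClass τ} {Λ : Type u} (M : K.Obj)
    (h : #M.str.carrier ≤ #Λ) : ∃ p : K.ObjOn Λ, Nonempty (M ≅ p.toObj) := by
  obtain ⟨e⟩ := h
  let ε : M.str.carrier ≃ Set.range e := Equiv.ofInjective e e.injective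
  let N : Str τ := ⟨Set.range e, fun s x => ε (M.str.fn s (ε.symm ∘ x)),
    fun r x => M.str.rel r (ε.symm ∘ x)⟩
  have h₁ : ∀ {A : Type u} (x : A → M.str.carrier), ε.symm ∘ ε ∘ x = x := fun x =>
    funext fun a => ε.symm_apply_apply _
  let f : M.str ⟶ N := ⟨ε, ε.injective, fun s x => by
    change ε (M.str.fn s x) = ε (M.str.fn s (ε.symm ∘ ε ∘ x))
    rw [h₁], fun r x => by
    change M.str.rel r (ε.symm ∘ ε ∘ x) ↔ _
    rw [h₁]⟩
  let g : N ⟶ M.str := ⟨ε.symm, ε.symm.injective, fun s x => ε.symm_apply_apply _,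
    fun r x => Iff.rfl⟩
  have hf : K.strong f := K.of_iso f ε.surjective (Or.inl M.mem)
  refine ⟨⟨⟨Set.range e, N.fn, N.rel⟩, (K.mem_of_strong hf).2⟩,
    ⟨⟨⟨f, hf⟩, ⟨g, K.of_iso g ε.symm.surjective (Or.inr M.mem)⟩, ?_, ?_⟩⟩⟩
  · exact hom_ext (funext ε.symm_apply_apply)
  · exact hom_ext (funext ε.apply_symm_apply)

end AbstractClass

namespace IndepRel

open AbstractClass

variable {μ : Cardinal.{u}} {τ : Vocabulary μ} {K : AbstractClass τ} {nf : IndepRel K.Obj}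

namespace NF

variable {hT : nf.RightTransitive} {hE : nf.Existence}

/-- The square is isomorphic to one with identity horizontal sides, which is independent. Isomorphic
arrows of `K` are thereby isomorphic in `C_NF`. -/
theorem indep_of_iso (hE : nf.Existence) (hinv : nf.Invariant) {A B A' B' : K.Obj} {f : A ⟶ B}
    {f' : A' ⟶ B'} (a : A ≅ A') (b : B ≅ B') (h : f ≫ b.hom = a.hom ≫ f') :
    nf.Indep f a.hom b.hom f' :=
  hinv f (𝟙 A) (𝟙 B) f f a.hom b.hom f' (Iso.refl A) (Iso.refl B) a b (by simp) (by simp)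
    (by simp) h (hE.indep_id f)

variable (nf hT hE) in
/-- The objects with source and target of size at most `lam`. -/
def smallObjects (lam : Cardinal.{u}) : ObjectProperty (nf.NF hT hE) := fun X =>
  #X.source.str.carrier ≤ lam ∧ #X.target.str.carrier ≤ lam

theorem essentiallySmall_smallObjects (hinv : nf.Invariant) (lam : Cardinal.{u}) :
    ObjectProperty.EssentiallySmall.{u} (smallObjects nf hT hE lam) := by
  let T : Type u := Σ p q : K.ObjOn lam.out, p.toObj ⟶ q.toObj
  let F : T → nf.NF hT hE := fun t => ⟨t.2.2⟩
  refine ⟨ObjectProperty.ofObj F, inferInstance, fun X hX => ?_⟩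
  obtain ⟨p, ⟨a⟩⟩ := exists_objOn_iso X.source (hX.1.trans (mk_out lam).ge)
  obtain ⟨q, ⟨b⟩⟩ := exists_objOn_iso X.target (hX.2.trans (mk_out lam).ge)
  refine ⟨F ⟨p, q, a.inv ≫ X.map ≫ b.hom⟩, ⟨_⟩, ⟨⟨⟨a.hom, b.hom, ?_⟩, ⟨a.inv, b.inv, ?_⟩, ?_, ?_⟩⟩⟩
  · exact indep_of_iso hE hinv a b (by simp [F])
  · exact indep_of_iso hE hinv a.symm b.symm (by simp [F])
  · exact hom_ext a.hom_inv_id b.hom_inv_id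
  · exact hom_ext a.inv_hom_id b.inv_hom_id

end NF

end IndepRel

/-! ### Covering by small independent squares -/

theorem Cardinal.mk_iUnion_le_of_forall_le {ι α : Type u} {lam : Cardinal.{u}} (hlam : ℵ₀ ≤ lam)
    (s : ι → Set α) (hι : #ι ≤ lam) (hs : ∀ i, #(s i) ≤ lam) : #(⋃ i, s i) ≤ lam :=
  (mk_iUnion_le s).trans (mul_le_of_le hlam hι (ciSup_le' hs))

theorem Cardinal.mk_union_le_of_le {α : Type u} {lam : Cardinal.{u}} (hlam : ℵ₀ ≤ lam)
    {s t : Set α} (hs : #s ≤ lam) (ht : #t ≤ lam) : #(s ∪ t : Set α) ≤ lam :=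
  (mk_union_le s t).trans (add_le_of_le hlam hs ht)

namespace AbstractClass

variable {μ : Cardinal.{u}} {τ : Vocabulary μ} {K : AbstractClass τ}

theorem mk_range_fn {M N : K.Obj} (f : M ⟶ N) : #(Set.range (fn f)) = #M.str.carrier :=
  mk_range_eq _ (fn_injective f)

/-- The union of a directed family of strong substructures is a strong substructure. -/
theorem IsMuAEC.exists_range_eq_iUnion (hK : K.IsMuAEC) (hμ : μ.IsRegular) {I : Type u}
    [PartialOrder I] (hI : MuDirected μ I) {N : K.Obj} (A : I → K.Obj) (a : ∀ i, A i ⟶ N)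
    (h : ∀ i j, i ≤ j → Set.range (fn (a i)) ⊆ Set.range (fn (a j))) :
    ∃ (B : K.Obj) (b : B ⟶ N), Set.range (fn b) = ⋃ i, Set.range (fn (a i)) := by
  choose m hm using fun i j hij => hK.exists_factor (a i) (a j) (h i j hij)
  let D : I ⥤ K.Obj :=
    { obj := A
      map := fun f => m _ _ (leOfHom f)
      map_id := fun i => (cancel_mono (a i)).1 (by rw [hm, Category.id_comp])
      map_comp := fun {i j k} f g => (cancel_mono (a k)).1 (by rw [Category.assoc, hm, hm, hm]) }
  obtain ⟨c, hc⟩ := hK.exists_union hμ hI D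
  obtain ⟨b, hb⟩ := hK.exists_desc hμ hI hc ⟨N, ⟨a, fun i j f =>
    (hm i j (leOfHom f)).trans (Category.comp_id _).symm⟩⟩
  refine ⟨c.pt, b, Set.Subset.antisymm ?_ (Set.iUnion_subset fun i => ?_)⟩
  · rintro _ ⟨x, rfl⟩
    obtain ⟨i, y, rfl⟩ := hc x
    exact Set.mem_iUnion.2 ⟨i, y, (congrFun (congrArg fn (hb i)) y).symm⟩
  · rw [← show c.ι.app i ≫ b = a i from hb i]
    exact range_fn_comp_subset _ b

end AbstractClass

namespace IndepRel

open AbstractClass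

variable {μ : Cardinal.{u}} {τ : Vocabulary μ} {K : AbstractClass τ} {nf : IndepRel K.Obj}

/-- Every small subset of the target of `f` is covered by a small morphism with an independent
square to `f`. -/
theorem exists_indep_small (hμ : μ.IsRegular) (hK : K.IsMuAEC) (hsym : nf.Symmetric)
    (hT : nf.RightTransitive) (hE : nf.Existence) (hU : nf.Uniqueness) {θ ν lam : Cardinal.{u}}
    (hw : nf.RightWitnessPropertyAt θ) (hν : ν.IsRegular) (hμν : μ ≤ ν) (hθν : θ ≤ ν)
    (hνlam : ν ≤ lam) (hpow : lam ^ θ ≤ lam)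
    (hLS : ∀ (M : K.Obj) (S : Set M.str.carrier), #S ≤ lam →
      ∃ (A : K.Obj) (a : A ⟶ M), S ⊆ Set.range (fn a) ∧ #A.str.carrier ≤ lam)
    (hlc : ∀ (M N : K.Obj) (i : M ⟶ N) (s : Set N.str.carrier), #s < θ →
      ∃ (A : K.Obj) (k : A ⟶ M), #A.str.carrier ≤ lam ∧
        nf.Closure (k ≫ i) s (Set.range (fn i)))
    {M N : K.Obj} (f : M ⟶ N) (S : Set N.str.carrier) (hS : #S ≤ lam) :
    ∃ (A B : K.Obj) (a : A ⟶ M) (b : B ⟶ N) (g : A ⟶ B), #A.str.carrier ≤ lam ∧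
      #B.str.carrier ≤ lam ∧ S ⊆ Set.range (fn b) ∧ fn f ⁻¹' S ⊆ Set.range (fn a) ∧
        nf.Indep g a b f := by
  have hlam : ℵ₀ ≤ lam := hν.aleph0_le.trans hνlam
  -- `T` is the base from local character; by base monotonicity every larger base works as well.
  have hbase : ∀ s : Set N.str.carrier, #s < θ → ∃ T : Set M.str.carrier, #T ≤ lam ∧
      ∀ (A : K.Obj) (a : A ⟶ M), T ⊆ Set.range (fn a) →
        nf.Closure (a ≫ f) s (Set.range (fn f)) := by
    intro s hs
    obtain ⟨A, k, hA, hcl⟩ := hlc M N f s hs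
    refine ⟨Set.range (fn k), (mk_range_fn k).le.trans hA, fun B b hb => ?_⟩
    obtain ⟨k', rfl⟩ := hK.exists_factor k b hb
    exact hcl.base_mono hK hT hE hU
  choose! W hW hWcl using hbase
  -- `H T` collects bases for all subsets of `T` of size less than `θ`; `lam ^ θ ≤ lam` keeps it of
  -- size at most `lam`.
  let H : Set N.str.carrier → Set M.str.carrier := fun T =>
    ⋃ s : {s : Set N.str.carrier // s ⊆ T ∧ #s < θ}, W s
  have hH : ∀ T : Set N.str.carrier, #T ≤ lam → #(H T) ≤ lam := by
    intro T hTc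
    refine mk_iUnion_le_of_forall_le hlam _ ?_ fun s => hW s s.2.2
    refine le_trans ?_ ((mk_bounded_subset_le T θ).trans
      ((power_le_power_right (max_le hTc hlam)).trans hpow))
    exact mk_subtype_mono fun s hs => ⟨hs.1, hs.2.le⟩
  have hstep : ∀ T : Set N.str.carrier, #T ≤ lam → ∃ (R : Set N.str.carrier)
      (Q : Set M.str.carrier), T ⊆ R ∧ #R ≤ lam ∧ fn f ⁻¹' T ⊆ Q ∧ H T ⊆ Q ∧ Q ⊆ fn f ⁻¹' R ∧
        (∃ (A : K.Obj) (a : A ⟶ M), Set.range (fn a) = Q) ∧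
          ∃ (B : K.Obj) (b : B ⟶ N), Set.range (fn b) = R := by
    intro T hTc
    obtain ⟨A, a, ha, hA⟩ := hLS M (fn f ⁻¹' T ∪ H T) (mk_union_le_of_le hlam
      ((mk_preimage_of_injective _ _ (fn_injective f)).trans hTc) (hH T hTc))
    obtain ⟨B, b, hb, hB⟩ := hLS N (T ∪ Set.range (fn (a ≫ f))) (mk_union_le_of_le hlam hTc
      ((mk_range_fn _).le.trans hA))
    refine ⟨_, _, Set.subset_union_left.trans hb, (mk_range_fn b).le.trans hB,
      Set.subset_union_left.trans ha, Set.subset_union_right.trans ha, ?_, ⟨A, a, rfl⟩,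
      ⟨B, b, rfl⟩⟩
    rintro _ ⟨x, rfl⟩
    exact hb (Or.inr ⟨x, rfl⟩)
  choose! R Q hTR hR hTQ hHQ hQR hQa hRb using hstep
  let I := ν.ord.ToType
  have hdir : MuDirected ν I := muDirected_ord_toType hν
  have hIcard : #I ≤ lam := by rwa [mk_ord_toType]
  -- Closing off along `ν`: `μ ≤ ν` makes the unions strong submodels, and `θ ≤ ν` puts each set of
  -- size less than `θ` into one stage.
  let G : I → Set N.str.carrier := (wellFounded_lt (α := I)).fix
    fun i prev => R (S ∪ ⋃ j : Set.Iio i, prev j.1 j.2)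
  let T : I → Set N.str.carrier := fun i => S ∪ ⋃ j : Set.Iio i, G j
  have hG : ∀ i, G i = R (T i) := fun i => WellFounded.fix_eq _ _ _
  have hTc : ∀ i, #(T i) ≤ lam := by
    intro i
    induction i using WellFoundedLT.induction with
    | ind i ih =>
      refine mk_union_le_of_le hlam hS (mk_iUnion_le_of_forall_le hlam _
        ((mk_subtype_le _).trans hIcard) fun j => ?_)
      rw [hG]
      exact hR _ (ih j j.2)
  have hGT : ∀ i j, i < j → R (T i) ⊆ T j := fun i j hij => by
    rw [← hG]
    exact (Set.subset_iUnion (fun j : Set.Iio j => G j) ⟨i, hij⟩).trans Set.subset_union_right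
  choose A a ha using fun i => hQa _ (hTc i)
  choose B b hb using fun i => hRb _ (hTc i)
  obtain ⟨A', a', ha'⟩ := hK.exists_range_eq_iUnion hμ (hdir.mono hμν) A a (fun i j hij => by
    rcases hij.eq_or_lt with rfl | hij
    · exact subset_rfl
    rw [ha, ha]
    exact (hQR _ (hTc i)).trans ((Set.preimage_mono (hGT i j hij)).trans (hTQ _ (hTc j))))
  obtain ⟨B', b', hb'⟩ := hK.exists_range_eq_iUnion hμ (hdir.mono hμν) B b (fun i j hij => by
    rcases hij.eq_or_lt with rfl | hij
    · exact subset_rfl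
    rw [hb, hb]
    exact (hGT i j hij).trans (hTR _ (hTc j)))
  simp only [ha] at ha'
  simp only [hb] at hb'
  obtain ⟨g, hg⟩ := hK.exists_factor (a' ≫ f) b' (by
    rw [fn_comp, Set.range_comp, ha', hb', Set.image_iUnion]
    exact Set.iUnion_mono fun i => Set.image_subset_iff.2 (hQR _ (hTc i)))
  obtain ⟨i₀⟩ := hdir.nonempty hν
  have hST : S ⊆ T i₀ := Set.subset_union_left
  refine ⟨A', B', a', b', g, ?_, ?_, ?_, ?_, hsym.swap (hw _ _ _ _ hg.symm fun X hX => ?_)⟩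
  · rw [← mk_range_fn a', ha']
    refine mk_iUnion_le_of_forall_le hlam _ hIcard fun i => ?_
    exact (mk_le_mk_of_subset (hQR _ (hTc i))).trans
      ((mk_preimage_of_injective _ _ (fn_injective f)).trans (hR _ (hTc i)))
  · rw [← mk_range_fn b', hb']
    exact mk_iUnion_le_of_forall_le hlam _ hIcard fun i => hR _ (hTc i)
  · rw [hb']
    exact (hST.trans (hTR _ (hTc i₀))).trans (Set.subset_iUnion (fun i => R (T i)) i₀)
  · rw [ha']
    exact ((Set.preimage_mono hST).trans (hTQ _ (hTc i₀))).trans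
      (Set.subset_iUnion (fun i => Q (T i)) i₀)
  · have hX' : #(fn b' '' X) < θ := mk_image_le.trans_lt hX
    have hmem : ∀ x : fn b' '' X, ∃ i, (x : N.str.carrier) ∈ R (T i) := fun x => by
      have : (x : N.str.carrier) ∈ Set.range (fn b') := Set.image_subset_range _ _ x.2
      rw [hb'] at this
      exact Set.mem_iUnion.1 this
    choose i hi using hmem
    obtain ⟨j, hj⟩ := hdir.exists_le_range (hX'.trans_le hθν) i
    -- `T k` contains `R (T j)` only for `j < k`. The base `W` of the image of `X` is then added to
    -- `Q (T k)`, so it lies in `A'`.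
    obtain ⟨k, hk⟩ : ∃ k, j < k := by
      have := noMaxOrder hν.aleph0_le
      exact exists_gt j
    have hXk : fn b' '' X ⊆ T k := fun x hx => hGT _ k ((hj ⟨x, hx⟩).trans_lt hk) (hi ⟨x, hx⟩)
    refine Closure.symm hsym (hWcl _ hX' A' a' ?_)
    rw [ha']
    refine Set.Subset.trans ?_ (Set.subset_iUnion (fun i => Q (T i)) k)
    exact (Set.subset_iUnion (fun s : {s : Set N.str.carrier // s ⊆ T k ∧ #s < θ} => W s)
      ⟨_, hXk, hX'⟩).trans (hHQ _ (hTc k))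

end IndepRel

/-! ### Small generators and accessibility -/

namespace IndepRel

open AbstractClass

variable {μ : Cardinal.{u}} {τ : Vocabulary μ} {K : AbstractClass τ} {nf : IndepRel K.Obj}

namespace NF

variable {hT : nf.RightTransitive} {hE : nf.Existence}

/-- The ranges of small subobjects of an object of `C_NF`. -/
def SubIndex (lam : Cardinal.{u}) (X : nf.NF hT hE) : Type u :=
  {p : Set X.source.str.carrier × Set X.target.str.carrier //
    ∃ (Y : nf.NF hT hE) (a : Y ⟶ X), smallObjects nf hT hE lam Y ∧
      Set.range (fn (Hom.bot a)) = p.1 ∧ Set.range (fn (Hom.top a)) = p.2}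

instance (lam : Cardinal.{u}) (X : nf.NF hT hE) : PartialOrder (SubIndex lam X) :=
  inferInstanceAs (PartialOrder (Subtype _))

/-- If small independent subobjects are cofinal, then small objects generate. -/
theorem isCardinalFilteredGenerator {θ lam : Cardinal.{u}} (hμ : μ.IsRegular) (hK : K.IsMuAEC)
    (hsym : nf.Symmetric) (hU : nf.Uniqueness) (hlam : ℵ₀ ≤ lam)
    [hκ : Fact (Order.succ lam).IsRegular] (hμlam : μ ≤ lam) (hθ : θ ≤ lam)
    (hw : nf.RightWitnessPropertyAt θ)
    (hcof : ∀ (M N : K.Obj) (f : M ⟶ N) (S : Set N.str.carrier), #S ≤ lam →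
      ∃ (A B : K.Obj) (a : A ⟶ M) (b : B ⟶ N) (g : A ⟶ B), #A.str.carrier ≤ lam ∧
      #B.str.carrier ≤ lam ∧ S ⊆ Set.range (fn b) ∧ fn f ⁻¹' S ⊆ Set.range (fn a) ∧
        nf.Indep g a b f) :
    (smallObjects nf hT hE lam).IsCardinalFilteredGenerator (Order.succ lam) where
  le_isCardinalPresentable X hX := isCardinalPresentable hμ hK hsym hU _
    (hμlam.trans (Order.le_succ _)) (hθ.trans (Order.le_succ _)) hw X
    (Order.lt_succ_of_le hX.1) (Order.lt_succ_of_le hX.2)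
  exists_colimitsOfShape X := by
    have hcover : ∀ S : Set X.target.str.carrier, #S ≤ lam → ∃ p : SubIndex lam X,
        S ⊆ p.1.2 ∧ fn X.map ⁻¹' S ⊆ p.1.1 := by
      intro S hS
      obtain ⟨A, B, a, b, g, hA, hB, hb, ha, hI⟩ := hcof _ _ X.map S hS
      exact ⟨⟨(Set.range (fn a), Set.range (fn b)), ⟨g⟩, ⟨a, b, hI⟩, ⟨hA, hB⟩, rfl, rfl⟩, hb, ha⟩
    choose Y a hY ha₁ ha₂ using fun p : SubIndex lam X => p.2
    have hsmall : ∀ p : SubIndex lam X, #p.1.2 ≤ lam := fun p => by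
      rw [← ha₂ p, mk_range_fn]
      exact (hY p).2
    have hmap : ∀ p : SubIndex lam X, p.1.1 ⊆ fn X.map ⁻¹' p.1.2 := fun p => by
      rw [← ha₁ p, ← ha₂ p]
      rintro _ ⟨x, rfl⟩
      exact ⟨fn (Y p).map x, congrFun (congrArg fn (nf.comm (Hom.indep (a p)))) x⟩
    -- It suffices to cover the union of the targets: the covering subobject also contains the
    -- preimage of that union under `X.map`, hence all the sources.
    have hdir : MuDirected (Order.succ lam) (SubIndex lam X) := by
      intro 𝒮 h𝒮
      obtain ⟨q, hq₂, hq₁⟩ := hcover (⋃ p : 𝒮, p.1.1.2)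
        (mk_iUnion_le_of_forall_le hlam _ (Order.le_of_lt_succ h𝒮) fun p => hsmall p)
      refine ⟨q, fun p hp => ?_⟩
      have h₂ : p.1.2 ⊆ ⋃ p : 𝒮, p.1.1.2 :=
        Set.subset_iUnion (fun p : 𝒮 => p.1.1.2) ⟨p, hp⟩
      exact ⟨((hmap p).trans (Set.preimage_mono h₂)).trans hq₁, h₂.trans hq₂⟩
    choose m hm using fun p q (hpq : p ≤ q) => exists_factor hK hU (a p) (a q)
      (by rw [ha₁, ha₁]; exact hpq.1) (by rw [ha₂, ha₂]; exact hpq.2)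
    let D : SubIndex lam X ⥤ nf.NF hT hE :=
      { obj := Y
        map := fun f => m _ _ (leOfHom f)
        map_id := fun p => (cancel_mono (a p)).1 (by rw [hm, Category.id_comp])
        map_comp := fun {p q r} f g => (cancel_mono (a r)).1 (by rw [Category.assoc, hm, hm, hm]) }
    let c : D ⟶ (Functor.const _).obj X :=
      { app := a
        naturality := fun p q f => (hm p q (leOfHom f)).trans (Category.comp_id _).symm }
    have hone : (1 : Cardinal.{u}) ≤ lam := one_le_aleph0.trans hlam
    obtain ⟨hc⟩ := nonempty_isColimit (c := ⟨X, c⟩) hμ hK hsym hU hκ.out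
      (hμlam.trans (Order.le_succ _)) (hθ.trans (Order.le_succ _)) hw hdir
      (fun x => by
        obtain ⟨p, -, hp⟩ := hcover {fn X.map x} ((mk_singleton _).le.trans hone)
        refine ⟨p, ?_⟩
        change x ∈ Set.range (fn (Hom.bot (a p)))
        rw [ha₁]
        exact hp rfl)
      (fun x => by
        obtain ⟨p, hp, -⟩ := hcover {x} ((mk_singleton _).le.trans hone)
        refine ⟨p, ?_⟩
        change x ∈ Set.range (fn (Hom.top (a p)))
        rw [ha₂]
        exact hp rfl)
    exact ⟨SubIndex lam X, inferInstance, hdir.isCardinalFiltered,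
      ⟨⟨⟨D, c, hc⟩, hY⟩⟩⟩

end NF

theorem rightAccessible_of_rightWitnessProperty (hμ : μ.IsRegular) (hK : K.IsMuAEC)
    (hinv : nf.Invariant) (hsym : nf.Symmetric) (hT : nf.RightTransitive) (hE : nf.Existence)
    (hU : nf.Uniqueness) (hlc : nf.RightLocalCharacter) (hw : nf.RightWitnessProperty) :
    nf.RightAccessible := by
  obtain ⟨θ, -, hw⟩ := hw
  obtain ⟨lam₀, -, hlam₀, hLS⟩ := hK.lst
  choose lc hlc using hlc
  obtain ⟨lam₁, hlam₁⟩ : BddAbove (lc '' Set.Iio θ) := bddAbove_of_small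
  -- A regular length for the closing-off that is at least `μ` and `θ`. Taking `lam` to be a power
  -- of 2 with exponent at least `ν` gives `lam ^ x ≤ lam` for `x ≤ ν`; `lam₁` bounds the local
  -- character cardinals of all lengths below `θ`.
  let ν : Cardinal.{u} := Order.succ (μ ⊔ θ)
  have hν : ν.IsRegular := isRegular_succ (hμ.aleph0_le.trans le_sup_left)
  have hμν : μ ≤ ν := le_sup_left.trans (Order.le_succ _)
  have hθν : θ ≤ ν := le_sup_right.trans (Order.le_succ _)
  let lam : Cardinal.{u} := 2 ^ (ν ⊔ lam₀ ⊔ lam₁)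
  have hle : ν ⊔ lam₀ ⊔ lam₁ ≤ lam := (cantor _).le
  have hνlam : ν ≤ lam := (le_sup_left.trans le_sup_left).trans hle
  have hlam : ℵ₀ ≤ lam := hν.aleph0_le.trans hνlam
  have hpow : ∀ x ≤ ν, lam ^ x ≤ lam := by
    intro x hx
    change (2 ^ (ν ⊔ lam₀ ⊔ lam₁)) ^ x ≤ lam
    rw [← power_mul]
    refine power_le_power_left two_ne_zero (mul_le_of_le (hν.aleph0_le.trans
      (le_sup_left.trans le_sup_left)) le_rfl (hx.trans (le_sup_left.trans le_sup_left)))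
  have hκ : Fact (Order.succ lam).IsRegular := ⟨isRegular_succ hlam⟩
  have hμlam := hμν.trans hνlam
  have hθlam := hθν.trans hνlam
  have hLS' : ∀ (M : K.Obj) (S : Set M.str.carrier), #S ≤ lam →
      ∃ (A : K.Obj) (a : A ⟶ M), S ⊆ Set.range (fn a) ∧ #A.str.carrier ≤ lam := by
    intro M S hS
    obtain ⟨A, a, ha, hA⟩ := hLS M S
    refine ⟨A, a, ha, hA.trans (add_le_of_le hlam ?_ ?_)⟩
    · exact powerlt_le.2 fun x hx => (power_le_power_right hS).trans (hpow x (hx.le.trans hμν))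
    · exact (le_sup_right.trans le_sup_left).trans hle
  have hlc' : ∀ (M N : K.Obj) (i : M ⟶ N) (s : Set N.str.carrier), #s < θ →
      ∃ (A : K.Obj) (k : A ⟶ M), #A.str.carrier ≤ lam ∧
        nf.Closure (k ≫ i) s (Set.range (fn i)) := by
    intro M N i s hs
    obtain ⟨A, k, hA, h⟩ := hlc #s M N i s Subtype.val rfl
    rw [Subtype.range_coe] at h
    exact ⟨A, k, hA.trans ((hlam₁ ⟨_, hs, rfl⟩).trans (le_sup_right.trans hle)), h⟩
  have hgen := NF.isCardinalFilteredGenerator (hT := hT) (hE := hE) hμ hK hsym hU hlam hμlam hθlam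
    hw fun M N f S hS => exists_indep_small hμ hK hsym hT hE hU hw hν hμν hθν hνlam (hpow θ hθν)
      hLS' hlc' f S hS
  have := NF.essentiallySmall_smallObjects (nf := nf) (hT := hT) (hE := hE) hinv lam
  have := hgen.hasCardinalFilteredGenerator
  have := NF.hasCardinalFilteredColimits (hT := hT) (hE := hE) hμ hK hsym hU (Order.succ lam)
    (hμlam.trans (Order.le_succ _)) (hθlam.trans (Order.le_succ _)) hw
  exact ⟨hT, hE, ⟨_, hκ, {}⟩⟩

end IndepRel

theorem mainTheorem8 {μ : Cardinal.{u}} (hμ : μ.IsRegular) {τ : Vocabulary μ}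
    (K : AbstractClass τ) (hK : K.IsMuAEC) (hchain : K.HasChainBounds)
    (nf : IndepRel K.Obj) (hinv : nf.Invariant) (htrans : nf.Transitive)
    (hex : nf.Existence) (huniq : nf.Uniqueness) (hlc : nf.RightLocalCharacter) :
    nf.Symmetric ∧ (nf.RightWitnessProperty ∨ nf.LeftWitnessProperty → nf.Stable) := by
  have key : ∀ {M₀ M₁ M₂ M₃ : K.Obj} {f₁ : M₀ ⟶ M₁} {f₂ : M₀ ⟶ M₂} {g₁ : M₁ ⟶ M₃}
      {g₂ : M₂ ⟶ M₃}, nf.Indep f₁ f₂ g₁ g₂ → nf.Indep f₂ f₁ g₂ g₁ := fun h =>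
    IndepRel.symmetric_of_rightLocalCharacter hμ hK hchain htrans hex huniq hlc h
  have hsym : nf.Symmetric := by
    refine IndepRel.ext ?_
    funext M₀ M₁ M₂ M₃ f₁ f₂ g₁ g₂
    exact propext ⟨key, key⟩
  refine ⟨hsym, fun hw => ?_⟩
  have hw' : nf.RightWitnessProperty := by
    rcases hw with hw | hw
    · exact hw
    · rw [IndepRel.LeftWitnessProperty, ← hsym] at hw
      exact hw
  have hacc := IndepRel.rightAccessible_of_rightWitnessProperty hμ hK hinv hsym htrans.2 hex huniq
    hlc hw'
  refine ⟨hsym, htrans, ⟨?_, hacc⟩, hex, huniq⟩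
  rw [IndepRel.LeftAccessible, ← hsym]
  exact hacc
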